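/- Setting. For each index $t\in\mathbb N$ let $M\ge 2$ be the number of sites, $p$ the dimension, $n_1,\dots,n_M$ the sample sizes of the sites, $N=\sum_{m} n_m$, $n=\min_m n_m$, and $s_1,s_2$ positive integers, $s_0=\max(s_1,s_2)$; all of these depend on $t$, and limits, $o(\cdot)$ and "eventually" refer to $t\to\infty$. For $\mu^{(1)},\dots,\mu^{(M)}\in\mathbb R^p$ and symmetric positive definite $p\times p$ matrices $\Omega^{(1)},\dots,\Omega^{(M)}$, the data are independent vectors $X_i^{(m)}\sim N(\mu^{(m)},\Sigma^{(m)})$, $i\le n_m$, $m\le M$, with $\Sigma^{(m)}=(\Omega^{(m)})^{-1}$. For $k\le p$ put $S_{1,k}=\{j:\Omega^{(1)}_{j,k}=\cdots=\Omega^{(M)}_{j,k}\neq 0\}$ and $S_{2,k}=\{j:\Omega^{(1)}_{j,k},\dots,\Omega^{(M)}_{j,k}\text{ are not all equal}\}$. Given constants $0<C_{\min}<C_{\max}$, let $\Theta(s_1,s_2)$ be the set of all tuples $\Omega^{(\cdot)}=(\Omega^{(1)},\dots,\Omega^{(M)})$ of symmetric positive definite matrices with $\max_k|S_{1,k}|\le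 s_1$ and $\max_k|S_{2,k}|\le s_2$ such that, for every $m$, the smallest eigenvalue of $\Sigma^{(m)}$ is at least $C_{\min}$ and every diagonal entry of $\Sigma^{(m)}$ is at most $C_{\max}$. For tuples $A^{(\cdot)},B^{(\cdot)}$ of real $p\times p$ matrices and $r\ge 1$ define $p\times p$ matrices by $$(L_{1,r}(A^{(\cdot)},B^{(\cdot)}))_{j,k}=\Big(\frac1N\sum_{m=1}^M n_m|A^{(m)}_{j,k}-B^{(m)}_{j,k}|\Big)^r,\qquad (L_{2,r}(A^{(\cdot)},B^{(\cdot)}))_{j,k}=\Big(\frac1N\sum_{m=1}^M n_m(A^{(m)}_{j,k}-B^{(m)}_{j,k})^2\Big)^{r/2},$$ and let $\psi_1=\sqrt{\log(p)/N}$, $\psi_2=\sqrt{(M+\log p)/N}$. Theorem. Let $r\ge 1$, $0<C_{\min}<C_{\max}$, $\beta>1$, $K>0$ and $\kappa>0$. There is a constant $c>0$, depending only on these numbers, such that the following holds for all sequences as above and all mean vectors $\mu^{(m)}$ (which may depend on $t$). If $n\to\infty$, $p\to\infty$, $3\le s_1<p/2$, $2\le s_2<p/2$, $s_0^2\log^3(p)=o(N)$,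 $s_2^2M=o(N)$, and eventually $N\le K\,nM$ and $p\ge\kappa N^{\beta}$, then eventually $$\inf_{\widetilde\Omega^{(\cdot)}}\ \sup_{\Omega^{(\cdot)}\in\Theta(s_1,s_2)}\frac1p\,\mathbb E\,\|L_{1,r}(\widetilde\Omega^{(\cdot)},\Omega^{(\cdot)})\|_{\mathrm F}^2\ \ge\ c\,\big(s_1\psi_1^{2r}+s_2\psi_2^{2r}\big),$$ $$\inf_{\widetilde\Omega^{(\cdot)}}\ \sup_{\Omega^{(\cdot)}\in\Theta(s_1,s_2)}\frac1p\,\mathbb E\,\|L_{2,r}(\widetilde\Omega^{(\cdot)},\Omega^{(\cdot)})\|_{\mathrm F}^2\ \ge\ c\,\big(s_1\psi_1^{2r}+s_2\psi_2^{2r}\big),$$ where the infima run over all measurable functions $\widetilde\Omega^{(\cdot)}$ of the data with values in the $M$-tuples of real $p\times p$ matrices. -/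

import Mathlib

open MeasureTheory ProbabilityTheory Filter Asymptotics
open scoped ENNReal

noncomputable section

namespace PrecisionMinimax

/-- A tuple of `M` real `p × p` matrices. -/
abbrev MatTuple (M p : ℕ) : Type := Fin M → Matrix (Fin p) (Fin p) ℝ

/-- The pooled data: site `m` holds `n m` vectors of `ℝ^p`. -/
abbrev Data {M : ℕ} (n : Fin M → ℕ) (p : ℕ) : Type :=
  (m : Fin M) → Fin (n m) → EuclideanSpace ℝ (Fin p)

/-- The total sample size `N`. -/
def totalSize {M : ℕ} (n : Fin M → ℕ) : ℕ := ∑ m, n m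

/-- The minimal sample size of a site. -/
def minSize {M : ℕ} (n : Fin M → ℕ) : ℕ := ⨅ m, n m

/-- The joint law of the data: all observations are independent, and those of site `m` are
Gaussian with mean `μ m` and covariance matrix `(Ω m)⁻¹`. -/
def dataLaw {M p : ℕ} (n : Fin M → ℕ) (μ : Fin M → EuclideanSpace ℝ (Fin p))
    (Ω : MatTuple M p) : Measure (Data n p) :=
  Measure.pi fun m => Measure.pi fun _ : Fin (n m) => multivariateGaussian (μ m) (Ω m)⁻¹

/-- Rows `j` at which the entries `(j, k)` of the matrices share a common non-zero value. -/
def commonSupport {M p : ℕ} (Ω : MatTuple M p) (k : Fin p) : Set (Fin p) :=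
  {j | (∀ m m', Ω m j k = Ω m' j k) ∧ ∀ m, Ω m j k ≠ 0}

/-- Rows `j` at which the entries `(j, k)` of the matrices are not all equal. -/
def heteroSupport {M p : ℕ} (Ω : MatTuple M p) (k : Fin p) : Set (Fin p) :=
  {j | ¬ ∀ m m', Ω m j k = Ω m' j k}

/-- The sparsity class `Θ(s₁, s₂)`. -/
def sparseClass (M p s₁ s₂ : ℕ) : Set (MatTuple M p) :=
  {Ω | (∀ m, (Ω m).PosDef) ∧ (∀ k, (commonSupport Ω k).ncard ≤ s₁) ∧
    ∀ k, (heteroSupport Ω k).ncard ≤ s₂}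

/-- Tuples whose covariance matrices `(Ω m)⁻¹` have all their eigenvalues at least `Cmin` and
all their diagonal entries at most `Cmax`. -/
def regularClass (M p : ℕ) (Cmin Cmax : ℝ) : Set (MatTuple M p) :=
  {Ω | ∀ m, (∀ x ∈ spectrum ℝ (Ω m)⁻¹, Cmin ≤ x) ∧ ∀ j, (Ω m)⁻¹ j j ≤ Cmax}

/-- The weighted `ℓ₁` norm on `ℝ^M`. -/
def wnorm₁ {M : ℕ} (n : Fin M → ℕ) (a : Fin M → ℝ) : ℝ :=
  1 / (totalSize n : ℝ) * ∑ m, (n m : ℝ) * |a m|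

/-- The weighted `ℓ₂` norm on `ℝ^M`. -/
def wnorm₂ {M : ℕ} (n : Fin M → ℕ) (a : Fin M → ℝ) : ℝ :=
  √(1 / (totalSize n : ℝ) * ∑ m, (n m : ℝ) * a m ^ 2)

/-- The integrative loss matrix `L_{1,r}`. -/
def lossMat₁ {M p : ℕ} (n : Fin M → ℕ) (r : ℝ) (A B : MatTuple M p) :
    Matrix (Fin p) (Fin p) ℝ :=
  Matrix.of fun j k => wnorm₁ n (fun m => A m j k - B m j k) ^ r

/-- The integrative loss matrix `L_{2,r}`. -/
def lossMat₂ {M p : ℕ} (n : Fin M → ℕ) (r : ℝ) (A B : MatTuple M p) :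
    Matrix (Fin p) (Fin p) ℝ :=
  Matrix.of fun j k => wnorm₂ n (fun m => A m j k - B m j k) ^ r

/-- The Frobenius norm of a square matrix. -/
def frobNorm {p : ℕ} (A : Matrix (Fin p) (Fin p) ℝ) : ℝ := √(∑ j, ∑ k, A j k ^ 2)

/-- An estimator: a measurable function of the data with values in the tuples of matrices. -/
def Estimator {M : ℕ} (n : Fin M → ℕ) (p : ℕ) : Type :=
  {T : Data n p → MatTuple M p // ∀ m j k, Measurable fun X => T X m j k}

/-- The risk `(1/p) E ‖L(T, Ω)‖_F²` of the estimator `T` at `Ω`, as an extended non-negative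
real number, for the loss matrix `L`. -/
def risk {M p : ℕ} (n : Fin M → ℕ) (μ : Fin M → EuclideanSpace ℝ (Fin p))
    (L : MatTuple M p → MatTuple M p → Matrix (Fin p) (Fin p) ℝ)
    (T : Estimator n p) (Ω : MatTuple M p) : ℝ≥0∞ :=
  ∫⁻ X, ENNReal.ofReal (1 / (p : ℝ) * frobNorm (L (T.1 X) Ω) ^ 2) ∂(dataLaw n μ Ω)

/-- The minimax risk over the tuples of matrices in the class `P`. -/
def minimaxRisk {M p : ℕ} (n : Fin M → ℕ) (μ : Fin M → EuclideanSpace ℝ (Fin p))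
    (L : MatTuple M p → MatTuple M p → Matrix (Fin p) (Fin p) ℝ)
    (P : Set (MatTuple M p)) : ℝ≥0∞ :=
  ⨅ T : Estimator n p, ⨆ Ω ∈ P, risk n μ L T Ω

/-- `ψ₁ = √(log p / N)`. -/
def psi₁ {M : ℕ} (n : Fin M → ℕ) (p : ℕ) : ℝ := √(Real.log p / (totalSize n : ℝ))

/-- `ψ₂ = √((M + log p) / N)`. -/
def psi₂ {M : ℕ} (n : Fin M → ℕ) (p : ℕ) : ℝ :=
  √(((M : ℝ) + Real.log p) / (totalSize n : ℝ))

end PrecisionMinimax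

end

open PrecisionMinimax

/-!
The lower bound for the loss `L_{1,r}` implies the one for `L_{2,r}`, because the weighted `ℓ₁` norm
is at most the weighted `ℓ₂` norm (`minimaxRisk_lossMat₁_le_lossMat₂`). Since
`ψ₂ ≤ ψ₁ + √(M / N)`, it is enough to bound the minimax risk from below by constant multiples of
`s₁ ψ₁ ^ (2r)`, of `s₂ ψ₁ ^ (2r)` and of `s₂ (M / N) ^ r`, each by the Bayes risk of a finite prior.

All the priors live on tuples `a I + E`, where `1 / a` lies strictly between `Cmin` and `Cmax`. The
vertices `1, …, p` contain two disjoint copies of `Fin s × Fin q` with `q = p / (2 s)`, and `E` couples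
the first copy to the second one through an `s × s` array of `q × q` blocks, each of them a weighted
permutation matrix (`permBlocks`, `bipartite`, `precisionTuple`). Every row and every column of `E`
then has at most `s` non-zero entries, whatever the permutations and the weights, so the sparsity
constraints hold and, for small weights, `E` is small in operator norm, which gives the eigenvalue
constraints. A positive fraction of the vertices is used, so the average column carries a number of
couplings proportional to `s`.

* For the rate `ψ₁`, all weights equal `ε`, a small multiple of `ψ₁`, and the permutations are uniform
  and independent. Composing one permutation with the transpositions `(i j)`, `j < q`, gives `q`
  hypotheses on the position of one coupling; their `χ²`-divergences from one of them are at most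
  `exp (O (N ε²)) ≤ q / 4`, so the position cannot be recovered. With the couplings present at all
  sites and `s = s₁ - 1` this yields `s₁ ψ₁ ^ (2r)`; removing them at a single site turns the common
  entries into heterogeneous ones and yields `s₂ ψ₁ ^ (2r)`.
* For `s₂ (M / N) ^ r` the permutations are fixed, one site has no couplings, and at every other site
  `m` each coupling is independently `0` or a small multiple of `1 / √(n m)`. Flipping one of them
  changes the law by a bounded `χ²`-divergence, so a fixed fraction of the switches is misread.
  Convexity of `x ^ (2r)` turns the expected number of errors into a bound on the risk.

Both arguments rest on `sum_measureReal_success_le`. If `P'` has a density with second moment at most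
`B` with respect to `P` (`SecondMomentBound`), then `P' A ^ 2 ≤ B * P A`, so disjoint events `A j`
cannot all be likely under the respective `P' j`: their average probability is at most `√(B / |F|)`.
For Gaussian laws with precision matrices `S` and `S - D` the second moment is
`det S / √(det (S - D) det (S + D))`, which is at most `exp (‖D‖_F² / b²)` when `S ≥ b`
(`det_div_sqrt_le_exp`), and second moments multiply over independent observations
(`secondMomentBound_dataLaw`).
-/

namespace PrecisionMinimax

/-! ### Product densities and the density of the multivariate Gaussian law -/

section ProductDensity

variable {ι : Type*} [Fintype ι] {α : ι → Type*} [∀ i, MeasurableSpace (α i)]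

/-- A product of measures with densities has the product density as soon as the integral of a product
function over a box factorizes. Stated with this factorization as a hypothesis so that it serves both
for probability measures and for the Lebesgue measure. -/
theorem pi_withDensity_of_lintegral_indicator (μ : ∀ i, Measure (α i))
    (f : ∀ i, α i → ℝ≥0∞) [∀ i, SigmaFinite ((μ i).withDensity (f i))]
    (h : ∀ s : ∀ i, Set (α i), (∀ i, MeasurableSet (s i)) →
      ∫⁻ x, ∏ i, (s i).indicator (f i) (x i) ∂(Measure.pi μ)
        = ∏ i, ∫⁻ x, (s i).indicator (f i) x ∂(μ i)) :
    Measure.pi (fun i => (μ i).withDensity (f i))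
      = (Measure.pi μ).withDensity (fun x => ∏ i, f i (x i)) := by
  classical
  refine Measure.pi_eq fun s hs => ?_
  have hm : MeasurableSet (Set.univ.pi s) := MeasurableSet.univ_pi hs
  rw [withDensity_apply _ hm, ← lintegral_indicator hm]
  have : (Set.univ.pi s).indicator (fun x => ∏ i, f i (x i))
      = fun x => ∏ i, (s i).indicator (f i) (x i) := by
    ext x
    by_cases hx : x ∈ Set.univ.pi s
    · rw [Set.indicator_of_mem hx]
      exact Finset.prod_congr rfl fun i _ => (Set.indicator_of_mem (hx i trivial) _).symm
    · rw [Set.indicator_of_notMem hx]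
      simp only [Set.mem_pi, Set.mem_univ, true_implies, not_forall] at hx
      obtain ⟨i, hi⟩ := hx
      exact (Finset.prod_eq_zero (Finset.mem_univ i) (Set.indicator_of_notMem hi _)).symm
  rw [this, h s hs]
  refine Finset.prod_congr rfl fun i _ => ?_
  rw [withDensity_apply _ (hs i), lintegral_indicator (hs i)]

theorem lintegral_pi_prod (μ : ∀ i, Measure (α i)) [∀ i, IsProbabilityMeasure (μ i)]
    (f : ∀ i, α i → ℝ≥0∞) (hf : ∀ i, Measurable (f i)) :
    ∫⁻ x, ∏ i, f i (x i) ∂(Measure.pi μ) = ∏ i, ∫⁻ x, f i x ∂(μ i) := by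
  refine (lintegral_prod_eq_prod_lintegral_of_indepFun Finset.univ
    (fun i (x : ∀ i, α i) => f i (x i)) (iIndepFun_pi fun i => (hf i).aemeasurable)
    (fun i => (hf i).comp (measurable_pi_apply i))).trans ?_
  refine Finset.prod_congr rfl fun i _ => ?_
  exact (measurePreserving_eval μ i).lintegral_comp (hf i)

theorem pi_withDensity (μ : ∀ i, Measure (α i)) [∀ i, IsProbabilityMeasure (μ i)]
    (f : ∀ i, α i → ℝ≥0∞) (hf : ∀ i, Measurable (f i))
    [∀ i, SigmaFinite ((μ i).withDensity (f i))] :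
    Measure.pi (fun i => (μ i).withDensity (f i))
      = (Measure.pi μ).withDensity (fun x => ∏ i, f i (x i)) :=
  pi_withDensity_of_lintegral_indicator μ f fun s hs =>
    lintegral_pi_prod μ (fun i => (s i).indicator (f i)) fun i => (hf i).indicator (hs i)

end ProductDensity

theorem pi_gaussianReal_eq_withDensity {ι : Type*} [Fintype ι] :
    Measure.pi (fun _ : ι => gaussianReal 0 1)
      = (volume : Measure (ι → ℝ)).withDensity (fun x => ∏ i, gaussianPDF 0 1 (x i)) := by
  have h1 : gaussianReal 0 1 = volume.withDensity (gaussianPDF 0 1) :=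
    gaussianReal_of_var_ne_zero 0 one_ne_zero
  have hsf : SigmaFinite (volume.withDensity (gaussianPDF 0 1)) := by rw [← h1]; infer_instance
  simp_rw [h1]
  refine pi_withDensity_of_lintegral_indicator (fun _ => volume) (fun _ => gaussianPDF 0 1)
    fun s hs => ?_
  have hind : ∀ i x, (s i).indicator (gaussianPDF 0 1) x
      = ENNReal.ofReal ((s i).indicator (gaussianPDFReal 0 1) x) := by
    intro i x
    by_cases hx : x ∈ s i <;> simp [hx, gaussianPDF]
  have hint : ∀ i, Integrable ((s i).indicator (gaussianPDFReal 0 1)) :=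
    fun i => (integrable_gaussianPDFReal 0 1).indicator (hs i)
  have hnn : ∀ i x, 0 ≤ (s i).indicator (gaussianPDFReal 0 1) x :=
    fun i x => Set.indicator_nonneg (fun y _ => gaussianPDFReal_nonneg 0 1 y) x
  simp_rw [hind, ← ENNReal.ofReal_prod_of_nonneg fun i _ => hnn i _]
  -- the Lebesgue measure is not finite, so the factorization comes from the Bochner integral
  have hI : Integrable (fun x : ι → ℝ => ∏ i, (s i).indicator (gaussianPDFReal 0 1) (x i)) :=
    Integrable.fintype_prod hint
  rw [← volume_pi, ← ofReal_integral_eq_lintegral_ofReal hI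
    (Eventually.of_forall fun x => Finset.prod_nonneg fun i _ => hnn i (x i)),
    integral_fintype_prod_volume_eq_prod,
    ENNReal.ofReal_prod_of_nonneg fun i _ => integral_nonneg (hnn i)]
  exact Finset.prod_congr rfl fun i _ =>
    ofReal_integral_eq_lintegral_ofReal (hint i) (Eventually.of_forall (hnn i))

/-- The density of the Gaussian law on `ℝ^ι` with mean `μ` and precision matrix `Ω`. -/
noncomputable def gaussianDensity {ι : Type*} [Fintype ι] [DecidableEq ι]
    (μ : EuclideanSpace ℝ ι) (Ω : Matrix ι ι ℝ) (x : EuclideanSpace ℝ ι) : ℝ :=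
  √Ω.det * (√(2 * Real.pi))⁻¹ ^ Fintype.card ι *
    Real.exp (-((x - μ).ofLp ⬝ᵥ Ω.mulVec (x - μ).ofLp) / 2)

section Gaussian

variable {ι : Type*} [Fintype ι] [DecidableEq ι]

theorem measurable_gaussianDensity (μ : EuclideanSpace ℝ ι) (Ω : Matrix ι ι ℝ) :
    Measurable (gaussianDensity μ Ω) := by
  have : Continuous (gaussianDensity μ Ω) := by
    unfold gaussianDensity Matrix.mulVec dotProduct
    fun_prop
  exact this.measurable

theorem gaussianDensity_pos (μ : EuclideanSpace ℝ ι) {Ω : Matrix ι ι ℝ} (h : Ω.PosDef)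
    (x : EuclideanSpace ℝ ι) : 0 < gaussianDensity μ Ω x := by
  have := h.det_pos
  unfold gaussianDensity
  positivity

theorem withDensity_map_equiv {α β : Type*} [MeasurableSpace α] [MeasurableSpace β]
    (e : α ≃ᵐ β) (μ : Measure α) (f : α → ℝ≥0∞) (hf : Measurable f) :
    (μ.withDensity f).map e = (μ.map e).withDensity (f ∘ e.symm) := by
  ext s hs
  rw [Measure.map_apply e.measurable hs, withDensity_apply _ (e.measurable hs),
    withDensity_apply _ hs, setLIntegral_map hs (hf.comp e.symm.measurable) e.measurable]
  simp

theorem stdGaussian_eq_withDensity :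
    stdGaussian (EuclideanSpace ℝ ι)
      = volume.withDensity (fun x => ENNReal.ofReal (gaussianDensity 0 1 x)) := by
  have h2 := withDensity_map_equiv (MeasurableEquiv.toLp 2 (ι → ℝ)) volume
    (fun x => ∏ i, gaussianPDF 0 1 (x i))
    (Finset.measurable_prod _ fun i _ => (measurable_gaussianPDF 0 1).comp (measurable_pi_apply i))
  have h3 : Measure.map (MeasurableEquiv.toLp 2 (ι → ℝ)) volume
      = (volume : Measure (EuclideanSpace ℝ ι)) := (PiLp.volume_preserving_toLp ι).map_eq
  rw [h3, ← pi_gaussianReal_eq_withDensity] at h2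
  rw [← map_pi_eq_stdGaussian]
  refine h2.trans ?_
  congr 1
  ext x
  simp only [Function.comp_apply, gaussianPDF]
  rw [← ENNReal.ofReal_prod_of_nonneg fun i _ => gaussianPDFReal_nonneg 0 1 _]
  congr 1
  simp only [gaussianPDFReal, gaussianDensity, Finset.prod_mul_distrib, ← Real.exp_sum]
  simp [dotProduct, Finset.sum_div, neg_div, pow_two]

open scoped MatrixOrder in
theorem exists_multivariateGaussian_eq_map (μ : EuclideanSpace ℝ ι) {S : Matrix ι ι ℝ}
    (hS : S.PosSemidef) :
    ∃ R : Matrix ι ι ℝ, R * R = S ∧ R.transpose = R ∧ R.det = √S.det ∧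
      multivariateGaussian μ S = (stdGaussian (EuclideanSpace ℝ ι)).map
        (fun x => μ + Matrix.toEuclideanCLM (𝕜 := ℝ) R x) := by
  refine ⟨CFC.sqrt S, CFC.sqrt_mul_sqrt_self _ hS.nonneg, ?_, ?_, rfl⟩
  · have := (Matrix.nonneg_iff_posSemidef.1 (CFC.sqrt_nonneg S)).isHermitian
    simpa [Matrix.IsHermitian] using this
  · simpa using hS.det_sqrt

/-- The Gaussian law with covariance matrix `Ω⁻¹` has the density `gaussianDensity μ Ω`. -/
theorem multivariateGaussian_inv_eq_withDensity (μ : EuclideanSpace ℝ ι) {Ω : Matrix ι ι ℝ}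
    (hΩ : Ω.PosDef) :
    multivariateGaussian μ Ω⁻¹
      = volume.withDensity (fun x => ENNReal.ofReal (gaussianDensity μ Ω x)) := by
  obtain ⟨R, hRR, hRT, hRdet, hmap⟩ := exists_multivariateGaussian_eq_map μ hΩ.inv.posSemidef
  have hdpos : 0 < √Ω.det := Real.sqrt_pos.2 hΩ.det_pos
  -- the law is the image of the standard Gaussian law under `x ↦ μ + R x` with `R = Ω ^ (-1/2)`
  have hRdet' : R.det = (√Ω.det)⁻¹ := by
    rw [hRdet, Matrix.det_nonsing_inv, Ring.inverse_eq_inv', Real.sqrt_inv]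
  have hRu : IsUnit R.det := by rw [hRdet']; exact (inv_pos.2 hdpos).ne'.isUnit
  have hquad : R⁻¹ * R⁻¹ = Ω := by
    rw [← Matrix.mul_inv_rev, hRR, Matrix.nonsing_inv_nonsing_inv _ hΩ.det_pos.ne'.isUnit]
  have hcont : ∀ A : Matrix ι ι ℝ, Measurable fun x : EuclideanSpace ℝ ι =>
      Matrix.toEuclideanCLM (𝕜 := ℝ) A x := fun A => (ContinuousLinearMap.continuous _).measurable
  let e : EuclideanSpace ℝ ι ≃ᵐ EuclideanSpace ℝ ι :=
    { toFun := fun x => μ + Matrix.toEuclideanCLM (𝕜 := ℝ) R x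
      invFun := fun y => Matrix.toEuclideanCLM (𝕜 := ℝ) R⁻¹ (y - μ)
      left_inv := fun x => by
        simp only [add_sub_cancel_left]
        rw [← mul_apply_eq_comp, ← map_mul, Matrix.nonsing_inv_mul _ hRu]; simp
      right_inv := fun x => by
        simp only
        rw [← mul_apply_eq_comp, ← map_mul, Matrix.mul_nonsing_inv _ hRu]; simp
      measurable_toFun := (hcont R).const_add μ
      measurable_invFun := (hcont R⁻¹).comp (measurable_id.sub_const μ) }
  have hvol : (volume : Measure (EuclideanSpace ℝ ι)).map e
      = ENNReal.ofReal (√Ω.det) • volume := by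
    have h1 : (volume : Measure (EuclideanSpace ℝ ι)).map (Matrix.toEuclideanLin R)
        = ENNReal.ofReal (√Ω.det) • volume := by
      have hd : LinearMap.det (Matrix.toEuclideanLin R) = R.det := LinearMap.det_toLpLin 2 R
      rw [Measure.map_linearMap_addHaar_eq_smul_addHaar _ (by rw [hd]; exact hRu.ne_zero), hd,
        hRdet', inv_inv, abs_of_pos hdpos]
    have h2 : (e : EuclideanSpace ℝ ι → EuclideanSpace ℝ ι)
        = (fun x => μ + x) ∘ (Matrix.toEuclideanLin R) := rfl
    have h3 : Measurable (Matrix.toEuclideanLin R) := hcont R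
    rw [h2, ← Measure.map_map (measurable_const_add μ) h3, h1, Measure.map_smul,
      map_add_left_eq_self]
  have hstep : multivariateGaussian μ Ω⁻¹ = (stdGaussian (EuclideanSpace ℝ ι)).map e := hmap
  have hm : Measurable fun x : EuclideanSpace ℝ ι => ENNReal.ofReal (gaussianDensity 0 1 x) :=
    (measurable_gaussianDensity 0 1).ennreal_ofReal
  rw [hstep, stdGaussian_eq_withDensity, withDensity_map_equiv e _ _ hm, hvol,
    withDensity_smul_measure, ← withDensity_smul _ (hm.comp e.symm.measurable)]
  congr 1
  ext y
  simp only [Pi.smul_apply, Function.comp_apply, smul_eq_mul]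
  rw [← ENNReal.ofReal_mul hdpos.le]
  congr 1
  have he : (e.symm y).ofLp = R⁻¹.mulVec (y - μ).ofLp := rfl
  have hinvT : R⁻¹.transpose = R⁻¹ := by rw [Matrix.transpose_nonsing_inv, hRT]
  simp only [gaussianDensity, sub_zero, Matrix.det_one, Real.sqrt_one, one_mul, he,
    Matrix.one_mulVec]
  rw [mul_assoc, Matrix.dotProduct_mulVec, ← Matrix.mulVec_transpose, Matrix.mulVec_mulVec, hinvT,
    hquad, dotProduct_comm]

end Gaussian

/-! ### The `χ²`-divergence of Gaussian laws -/

/-- `P'` has a density with respect to `P` whose second moment under `P` is at most `B`; in other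
words, the `χ²`-divergence of `P'` from `P` is at most `B - 1`. -/
def SecondMomentBound {α : Type*} [MeasurableSpace α] (P' P : Measure α) (B : ℝ≥0∞) : Prop :=
  ∃ L : α → ℝ≥0∞, Measurable L ∧ P' = P.withDensity L ∧ ∫⁻ x, L x ^ 2 ∂P ≤ B

namespace SecondMomentBound

variable {α : Type*} [MeasurableSpace α] {P' P : Measure α} {B : ℝ≥0∞}

theorem mono (h : SecondMomentBound P' P B) {B' : ℝ≥0∞} (hB : B ≤ B') :
    SecondMomentBound P' P B' := by
  obtain ⟨L, h1, h2, h3⟩ := h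
  exact ⟨L, h1, h2, h3.trans hB⟩

/-- Cauchy-Schwarz: an event which is rare under `P` is rare under `P'`. -/
theorem sq_measure_le (h : SecondMomentBound P' P B) {A : Set α} (hA : MeasurableSet A) :
    P' A ^ 2 ≤ B * P A := by
  obtain ⟨L, hL, rfl, hB⟩ := h
  rw [withDensity_apply _ hA, ← lintegral_indicator hA]
  have h1 : A.indicator L = L * A.indicator 1 := by
    ext x
    by_cases hx : x ∈ A <;> simp [hx]
  have h2 := ENNReal.lintegral_mul_le_Lp_mul_Lq P Real.HolderConjugate.two_two hL.aemeasurable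
    ((measurable_one.indicator hA).aemeasurable (μ := P) (f := A.indicator (1 : α → ℝ≥0∞)))
  have h3 : ∫⁻ a, (A.indicator (1 : α → ℝ≥0∞) a) ^ (2 : ℝ) ∂P = P A := by
    rw [← lintegral_indicator_one hA]
    congr 1
    ext x
    by_cases hx : x ∈ A <;> simp [hx]
  rw [h3] at h2
  simp only [ENNReal.rpow_ofNat] at h2
  have h4 : ∫⁻ a, A.indicator L a ∂P ≤ B ^ (1 / (2 : ℝ)) * P A ^ (1 / (2 : ℝ)) := by
    rw [h1]
    refine h2.trans ?_
    gcongr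
  calc _ ≤ (B ^ (1 / (2 : ℝ)) * P A ^ (1 / (2 : ℝ))) ^ 2 := by gcongr
    _ = B * P A := by
      rw [mul_pow, ← ENNReal.rpow_ofNat, ← ENNReal.rpow_ofNat, ← ENNReal.rpow_mul,
        ← ENNReal.rpow_mul]
      norm_num

/-- Second moments of densities multiply over independent components. -/
theorem pi {ι : Type*} [Fintype ι] {α : ι → Type*} [∀ i, MeasurableSpace (α i)]
    {P' P : ∀ i, Measure (α i)} [∀ i, IsProbabilityMeasure (P' i)]
    [∀ i, IsProbabilityMeasure (P i)] {B : ι → ℝ≥0∞}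
    (h : ∀ i, SecondMomentBound (P' i) (P i) (B i)) :
    SecondMomentBound (Measure.pi P') (Measure.pi P) (∏ i, B i) := by
  choose L hL hP hB using h
  have : ∀ i, SigmaFinite ((P i).withDensity (L i)) := fun i => by rw [← hP i]; infer_instance
  refine ⟨fun x => ∏ i, L i (x i),
    Finset.measurable_prod _ fun i _ => (hL i).comp (measurable_pi_apply i), ?_, ?_⟩
  · rw [← pi_withDensity P L hL]
    congr 1
    ext1 i
    exact hP i
  · simp_rw [← Finset.prod_pow]
    rw [lintegral_pi_prod P (fun i x => L i x ^ 2) fun i => (hL i).pow_const 2]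
    exact Finset.prod_le_prod' fun i _ => hB i

end SecondMomentBound

section GaussianDivergence

variable {ι : Type*} [Fintype ι] [DecidableEq ι]

/-- The square of the density with precision `S` is, up to a constant, the product of the densities
with precisions `S - D` and `S + D`. -/
theorem gaussianDensity_sq (μ : EuclideanSpace ℝ ι) {S D : Matrix ι ι ℝ}
    (hS : S.PosDef) (hSm : (S - D).PosDef) (hSp : (S + D).PosDef) (x : EuclideanSpace ℝ ι) :
    gaussianDensity μ S x ^ 2 = S.det / (√(S - D).det * √(S + D).det) *
      (gaussianDensity μ (S - D) x * gaussianDensity μ (S + D) x) := by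
  have h0 := Real.sq_sqrt hS.det_pos.le
  have h1 := (Real.sqrt_pos.2 hSm.det_pos).ne'
  have h2 := (Real.sqrt_pos.2 hSp.det_pos).ne'
  simp only [gaussianDensity, Matrix.sub_mulVec, Matrix.add_mulVec, dotProduct_sub, dotProduct_add]
  set v := (x - μ).ofLp
  set C := (√(2 * Real.pi))⁻¹ ^ Fintype.card ι
  have h3 : Real.exp (-(v ⬝ᵥ S.mulVec v) / 2) ^ 2
      = Real.exp (-(v ⬝ᵥ S.mulVec v - v ⬝ᵥ D.mulVec v) / 2)
        * Real.exp (-(v ⬝ᵥ S.mulVec v + v ⬝ᵥ D.mulVec v) / 2) := by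
    rw [← Real.exp_add, pow_two, ← Real.exp_add]
    congr 1
    ring
  rw [mul_pow, mul_pow, h3, h0]
  field_simp

/-- The identity `gaussianDensity_sq` integrates to the second moment, since the density with precision
`S + D` has total mass one. -/
theorem secondMomentBound_multivariateGaussian (μ : EuclideanSpace ℝ ι) {S D : Matrix ι ι ℝ}
    (hS : S.PosDef) (hSm : (S - D).PosDef) (hSp : (S + D).PosDef) :
    SecondMomentBound (multivariateGaussian μ S⁻¹) (multivariateGaussian μ (S - D)⁻¹)
      (ENNReal.ofReal (S.det / (√(S - D).det * √(S + D).det))) := by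
  have hm := fun Ω => (measurable_gaussianDensity μ Ω)
  have hL : Measurable fun x => ENNReal.ofReal (gaussianDensity μ S x / gaussianDensity μ (S - D) x)
    := ((hm S).div (hm (S - D))).ennreal_ofReal
  refine ⟨_, hL, ?_, ?_⟩
  · rw [multivariateGaussian_inv_eq_withDensity μ hS, multivariateGaussian_inv_eq_withDensity μ hSm,
      ← withDensity_mul _ (hm _).ennreal_ofReal hL]
    congr 1
    ext x
    have := gaussianDensity_pos μ hSm x
    rw [Pi.mul_apply, ← ENNReal.ofReal_mul this.le]
    congr 1
    field_simp
  · rw [multivariateGaussian_inv_eq_withDensity μ hSm,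
      lintegral_withDensity_eq_lintegral_mul _ (hm _).ennreal_ofReal (hL.pow_const 2)]
    have h1 : ∀ x, ((fun x => ENNReal.ofReal (gaussianDensity μ (S - D) x)) *
        fun x => ENNReal.ofReal (gaussianDensity μ S x / gaussianDensity μ (S - D) x) ^ 2) x
        = ENNReal.ofReal (S.det / (√(S - D).det * √(S + D).det))
          * ENNReal.ofReal (gaussianDensity μ (S + D) x) := by
      intro x
      have p1 := gaussianDensity_pos μ hSm x
      have p2 := gaussianDensity_pos μ hS x
      have p3 := hS.det_pos
      rw [Pi.mul_apply, ← ENNReal.ofReal_pow (by positivity), ← ENNReal.ofReal_mul p1.le,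
        ← ENNReal.ofReal_mul (by positivity), div_pow, gaussianDensity_sq μ hS hSm hSp]
      congr 1
      field_simp
    simp_rw [h1]
    rw [lintegral_const_mul _ (hm _).ennreal_ofReal]
    have h2 : ∫⁻ x, ENNReal.ofReal (gaussianDensity μ (S + D) x) = 1 := by
      have := congrArg (fun ν => ν Set.univ) (multivariateGaussian_inv_eq_withDensity μ hSp)
      simpa using this.symm
    rw [h2, mul_one]

end GaussianDivergence

section Determinant

variable {ι : Type*} [Fintype ι] [DecidableEq ι]

theorem one_sub_sum_le_prod_one_sub {κ : Type*} (s : Finset κ) (x : κ → ℝ) (h0 : ∀ i, 0 ≤ x i)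
    (h1 : ∀ i, x i ≤ 1) : 1 - ∑ i ∈ s, x i ≤ ∏ i ∈ s, (1 - x i) := by
  classical
  induction s using Finset.induction_on with
  | empty => simp
  | insert a s ha ih =>
    rw [Finset.sum_insert ha, Finset.prod_insert ha]
    have h2 : ∏ i ∈ s, (1 - x i) ≤ 1 :=
      Finset.prod_le_one (fun i _ => by linarith [h1 i]) fun i _ => by linarith [h0 i]
    nlinarith [h0 a]

theorem trace_mul_self_eq_sum {κ : Type*} [Fintype κ] {G : Matrix κ κ ℝ} (hG : G.transpose = G) :
    (G * G).trace = ∑ i, ∑ j, G i j ^ 2 := by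
  simp only [Matrix.trace, Matrix.diag, Matrix.mul_apply]
  refine Finset.sum_congr rfl fun i _ => Finset.sum_congr rfl fun j _ => ?_
  rw [pow_two]
  congr 1
  exact congrFun (congrFun hG i) j

/-- For a symmetric matrix `G` with eigenvalues `g i`, the determinant of `1 - G²` is
`∏ i, (1 - g i ^ 2) ≥ 1 - ∑ i, g i ^ 2`. -/
theorem one_sub_sum_sq_le_det {G : Matrix ι ι ℝ} (hG : G.transpose = G)
    (h : ∑ i, ∑ j, G i j ^ 2 ≤ 1) :
    1 - ∑ i, ∑ j, G i j ^ 2 ≤ ((1 - G) * (1 + G)).det := by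
  have hH : G.IsHermitian := by simpa [Matrix.IsHermitian] using hG
  set g := hH.eigenvalues
  set U : Matrix ι ι ℝ := (hH.eigenvectorUnitary : Matrix ι ι ℝ)
  have hU : U * star U = 1 := Unitary.mul_star_self_of_mem hH.eigenvectorUnitary.2
  have hU' : star U * U = 1 := Unitary.star_mul_self_of_mem hH.eigenvectorUnitary.2
  have hspec : G = U * Matrix.diagonal g * star U := by
    have := hH.spectral_theorem
    rw [Unitary.conjStarAlgAut_apply] at this
    exact this
  have hsq : G * G = U * Matrix.diagonal (fun i => g i ^ 2) * star U := by
    calc G * G = U * Matrix.diagonal g * (star U * U) * Matrix.diagonal g * star U := by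
          conv_lhs => rw [hspec]
          simp only [Matrix.mul_assoc]
      _ = _ := by
          rw [hU', Matrix.mul_one, Matrix.mul_assoc U, Matrix.diagonal_mul_diagonal]
          simp only [pow_two]
  have hdet : ((1 - G) * (1 + G)).det = ∏ i, (1 - g i ^ 2) := by
    have h1 : (1 - G) * (1 + G) = U * Matrix.diagonal (fun i => 1 - g i ^ 2) * star U := by
      have : Matrix.diagonal (fun i => 1 - g i ^ 2)
          = 1 - Matrix.diagonal (fun i => g i ^ 2) := by
        rw [← Matrix.diagonal_one, Matrix.diagonal_sub]
      have h2 : U * (1 - Matrix.diagonal fun i => g i ^ 2) * star U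
          = U * star U - U * Matrix.diagonal (fun i => g i ^ 2) * star U := by noncomm_ring
      rw [this, h2, hU, ← hsq]
      noncomm_ring
    rw [h1, Matrix.det_mul_right_comm, hU, Matrix.one_mul, Matrix.det_diagonal]
  have htr : ∑ i, ∑ j, G i j ^ 2 = ∑ i, g i ^ 2 := by
    rw [← trace_mul_self_eq_sum hG, hsq, Matrix.trace_mul_cycle, hU', Matrix.one_mul,
      Matrix.trace_diagonal]
  rw [hdet, htr]
  rw [htr] at h
  exact one_sub_sum_le_prod_one_sub _ _ (fun i => sq_nonneg _) fun i =>
    (Finset.single_le_sum (f := fun i => g i ^ 2) (fun i _ => sq_nonneg _)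
      (Finset.mem_univ i)).trans h

open scoped MatrixOrder in
theorem exists_symm_mul_self_eq {S : Matrix ι ι ℝ} (hS : S.PosSemidef) :
    ∃ R : Matrix ι ι ℝ, R * R = S ∧ R.transpose = R := by
  refine ⟨CFC.sqrt S, CFC.sqrt_mul_sqrt_self _ hS.nonneg, ?_⟩
  have := (Matrix.nonneg_iff_posSemidef.1 (CFC.sqrt_nonneg S)).isHermitian
  simpa [Matrix.IsHermitian] using this

/-- If `S ≥ b` as a quadratic form, then `S⁻¹ ≤ b⁻¹`. -/
theorem dotProduct_inv_mulVec_le {S : Matrix ι ι ℝ} (hS : S.PosDef) {b : ℝ} (hb : 0 < b)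
    (h : ∀ x : ι → ℝ, b * (x ⬝ᵥ x) ≤ x ⬝ᵥ S.mulVec x) (x : ι → ℝ) :
    x ⬝ᵥ S⁻¹.mulVec x ≤ b⁻¹ * (x ⬝ᵥ x) := by
  set y := S⁻¹.mulVec x with hy
  have hSy : S.mulVec y = x := by
    rw [hy, Matrix.mulVec_mulVec, Matrix.mul_nonsing_inv _ hS.det_pos.ne'.isUnit,
      Matrix.one_mulVec]
  have h1 := h y
  rw [hSy, dotProduct_comm y x] at h1
  have h2 : 0 ≤ (x - b • y) ⬝ᵥ (x - b • y) := Finset.sum_nonneg fun i _ => mul_self_nonneg _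
  simp only [sub_dotProduct, dotProduct_sub, smul_dotProduct, dotProduct_smul, smul_eq_mul,
    dotProduct_comm y x] at h2
  rw [inv_mul_eq_div, le_div_iff₀ hb]
  nlinarith

/-- Multiplication by `S ^ (-1/2)` shrinks the squared Frobenius norm by `b⁻¹` if `S ≥ b`. -/
theorem sum_sq_mul_le {S R : Matrix ι ι ℝ} (hS : S.PosDef) {b : ℝ} (hb : 0 < b)
    (h : ∀ x : ι → ℝ, b * (x ⬝ᵥ x) ≤ x ⬝ᵥ S.mulVec x) (hR : R * R = S⁻¹)
    (hRT : R.transpose = R) (X : Matrix ι ι ℝ) :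
    ∑ i, ∑ j, (R * X) i j ^ 2 ≤ b⁻¹ * ∑ i, ∑ j, X i j ^ 2 := by
  rw [Finset.sum_comm, Finset.sum_comm (f := fun i j => X i j ^ 2), Finset.mul_sum]
  refine Finset.sum_le_sum fun j _ => ?_
  have h1 := dotProduct_inv_mulVec_le hS hb h (X.col j)
  rw [← hR, ← Matrix.mulVec_mulVec, Matrix.dotProduct_mulVec, ← Matrix.mulVec_transpose, hRT] at h1
  simpa [dotProduct, Matrix.mulVec, Matrix.mul_apply, pow_two] using h1

/-- With `R = S ^ (-1/2)` and `G = R D R` one has `S ± D = R⁻¹ (1 ± G) R⁻¹`, which reduces the claim to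
`one_sub_sum_sq_le_det`. -/
theorem det_sq_mul_le {S D : Matrix ι ι ℝ} (hS : S.PosDef) (hD : D.transpose = D) {b : ℝ}
    (hb : 0 < b) (h : ∀ x : ι → ℝ, b * (x ⬝ᵥ x) ≤ x ⬝ᵥ S.mulVec x)
    (hsmall : (∑ i, ∑ j, D i j ^ 2) / b ^ 2 ≤ 1) :
    S.det ^ 2 * (1 - (∑ i, ∑ j, D i j ^ 2) / b ^ 2) ≤ (S - D).det * (S + D).det := by
  obtain ⟨R, hR, hRT⟩ := exists_symm_mul_self_eq hS.inv.posSemidef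
  have hdet : R.det * R.det * S.det = 1 := by
    rw [← Matrix.det_mul, hR, ← Matrix.det_mul, Matrix.nonsing_inv_mul _ hS.det_pos.ne'.isUnit,
      Matrix.det_one]
  set G := R * D * R with hGdef
  have hGT : G.transpose = G := by
    simp only [hGdef, Matrix.transpose_mul, hRT, hD, Matrix.mul_assoc]
  have hRSR : R * S * R = 1 := by
    have h1 : R * (R * S) = 1 := by
      rw [← Matrix.mul_assoc, hR, Matrix.nonsing_inv_mul _ hS.det_pos.ne'.isUnit]
    exact mul_eq_one_comm.1 h1
  have hG : ∑ i, ∑ j, G i j ^ 2 ≤ (∑ i, ∑ j, D i j ^ 2) / b ^ 2 := by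
    have h1 : ∑ i, ∑ j, (D * R) i j ^ 2 = ∑ i, ∑ j, (R * D) i j ^ 2 := by
      rw [Finset.sum_comm]
      refine Finset.sum_congr rfl fun i _ => Finset.sum_congr rfl fun j _ => ?_
      rw [← Matrix.transpose_apply (D * R), Matrix.transpose_mul, hRT, hD]
    calc _ = ∑ i, ∑ j, (R * (D * R)) i j ^ 2 := by rw [hGdef, Matrix.mul_assoc]
      _ ≤ b⁻¹ * (b⁻¹ * ∑ i, ∑ j, D i j ^ 2) := by
        refine (sum_sq_mul_le hS hb h hR hRT _).trans ?_
        rw [h1]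
        gcongr
        exact sum_sq_mul_le hS hb h hR hRT D
      _ = _ := by field_simp
  have h1 := one_sub_sum_sq_le_det hGT (hG.trans hsmall)
  have h2 : (1 - G) * (1 + G) = (R * (S - D) * R) * (R * (S + D) * R) := by
    have h3 : R * (S - D) * R = R * S * R - R * D * R := by noncomm_ring
    have h4 : R * (S + D) * R = R * S * R + R * D * R := by noncomm_ring
    rw [h3, h4, hRSR]
  rw [h2] at h1
  simp only [Matrix.det_mul] at h1
  have h3 : S.det ^ 2 * (1 - (∑ i, ∑ j, D i j ^ 2) / b ^ 2)
      ≤ S.det ^ 2 * (R.det * (S - D).det * R.det * (R.det * (S + D).det * R.det)) := by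
    gcongr
    linarith
  refine h3.trans_eq ?_
  calc _ = (R.det * R.det * S.det) ^ 2 * ((S - D).det * (S + D).det) := by ring
    _ = _ := by rw [hdet]; ring

theorem det_div_sqrt_le_exp {S D : Matrix ι ι ℝ} (hS : S.PosDef) (hSm : (S - D).PosDef)
    (hSp : (S + D).PosDef) (hD : D.transpose = D) {b : ℝ}
    (hb : 0 < b) (h : ∀ x : ι → ℝ, b * (x ⬝ᵥ x) ≤ x ⬝ᵥ S.mulVec x)
    (hsmall : (∑ i, ∑ j, D i j ^ 2) / b ^ 2 ≤ 1 / 2) :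
    S.det / (√(S - D).det * √(S + D).det) ≤ Real.exp ((∑ i, ∑ j, D i j ^ 2) / b ^ 2) := by
  have h1 := det_sq_mul_le hS hD hb h (by linarith)
  set f := (∑ i, ∑ j, D i j ^ 2) / b ^ 2 with hf
  have hf0 : 0 ≤ f := by positivity
  have hSd := hS.det_pos
  have hd := mul_pos hSm.det_pos hSp.det_pos
  rw [← Real.sqrt_mul hSm.det_pos.le, div_le_iff₀ (Real.sqrt_pos.2 hd)]
  refine (pow_le_pow_iff_left₀ hSd.le (by positivity) two_ne_zero).1 ?_
  rw [mul_pow, Real.sq_sqrt hd.le]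
  -- `exp (2 f) (1 - f) ≥ (1 + 2 f) (1 - f) ≥ 1` for `0 ≤ f ≤ 1 / 2`
  have h2 : 1 ≤ Real.exp f ^ 2 * (1 - f) := by
    have h3 := Real.add_one_le_exp (2 * f)
    rw [← Real.exp_nat_mul]
    push_cast
    nlinarith
  calc S.det ^ 2 ≤ S.det ^ 2 * (Real.exp f ^ 2 * (1 - f)) :=
        le_mul_of_one_le_right (by positivity) h2
    _ = Real.exp f ^ 2 * (S.det ^ 2 * (1 - f)) := by ring
    _ ≤ _ := by gcongr

end Determinant

/-- The `χ²`-divergence of two joint laws of the data with nearby precision matrices. -/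
theorem secondMomentBound_dataLaw {M p : ℕ} (n : Fin M → ℕ) (μ : Fin M → EuclideanSpace ℝ (Fin p))
    {S D : MatTuple M p} {b : ℝ} (hb : 0 < b) (hS : ∀ m, (S m).PosDef)
    (hSm : ∀ m, (S m - D m).PosDef) (hSp : ∀ m, (S m + D m).PosDef)
    (hD : ∀ m, (D m).transpose = D m)
    (h : ∀ m, ∀ x : Fin p → ℝ, b * (x ⬝ᵥ x) ≤ x ⬝ᵥ (S m).mulVec x)
    (hsmall : ∀ m, (∑ i, ∑ j, D m i j ^ 2) / b ^ 2 ≤ 1 / 2) :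
    SecondMomentBound (dataLaw n μ S) (dataLaw n μ fun m => S m - D m)
      (ENNReal.ofReal (Real.exp (∑ m, n m * ((∑ i, ∑ j, D m i j ^ 2) / b ^ 2)))) := by
  have h1 : SecondMomentBound (dataLaw n μ S) (dataLaw n μ fun m => S m - D m)
      (∏ m, ∏ _i : Fin (n m), ENNReal.ofReal (Real.exp ((∑ i, ∑ j, D m i j ^ 2) / b ^ 2))) :=
    SecondMomentBound.pi fun m => SecondMomentBound.pi fun _ =>
      (secondMomentBound_multivariateGaussian (μ m) (hS m) (hSm m) (hSp m)).mono
        (ENNReal.ofReal_le_ofReal (det_div_sqrt_le_exp (hS m) (hSm m) (hSp m) (hD m) hb (h m)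
          (hsmall m)))
  refine h1.mono (le_of_eq ?_)
  rw [Real.exp_sum, ENNReal.ofReal_prod_of_nonneg fun i _ => (Real.exp_pos _).le]
  refine Finset.prod_congr rfl fun m _ => ?_
  rw [Finset.prod_const, Finset.card_univ, Fintype.card_fin, Real.exp_nat_mul,
    ENNReal.ofReal_pow (Real.exp_pos _).le]

/-! ### Testing many hypotheses and the minimax risk -/

section Testing

variable {X : Type*} [MeasurableSpace X]

theorem SecondMomentBound.measureReal_sq_le {P' P : Measure X} [IsProbabilityMeasure P']
    [IsProbabilityMeasure P] {B : ℝ} (hB : 0 ≤ B) (h : SecondMomentBound P' P (ENNReal.ofReal B))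
    {A : Set X} (hA : MeasurableSet A) : P'.real A ^ 2 ≤ B * P.real A := by
  have h1 := ENNReal.toReal_mono (ENNReal.mul_ne_top ENNReal.ofReal_ne_top (measure_ne_top P A))
    (h.sq_measure_le hA)
  simpa [Measure.real, ENNReal.toReal_ofReal hB] using h1

/-- Identification of one coordinate `ℓ θ` of a uniform parameter `θ`, from disjoint decision regions
`A`. The bijections `τ j` move the coordinate through `|F|` distinct values while keeping the law close
to that of `θ`, and they preserve the uniform prior, so the average probability of success is at most
`√(B / |F|)`. -/
theorem sum_measureReal_success_le {Θ F F' : Type*} [Fintype Θ] [Fintype F] [Nonempty F]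
    (P : Θ → Measure X) [∀ θ, IsProbabilityMeasure (P θ)] (τ : F → Equiv.Perm Θ) (ℓ : Θ → F')
    (A : F' → Set X) (hA : ∀ j, MeasurableSet (A j)) (hdisj : Pairwise (Function.onFun Disjoint A))
    (hinj : ∀ θ, Function.Injective fun j => ℓ (τ j θ)) {B : ℝ} (hB : 0 ≤ B)
    (h : ∀ θ j, SecondMomentBound (P (τ j θ)) (P θ) (ENNReal.ofReal B)) :
    ∑ θ, (P θ).real (A (ℓ θ)) ≤ Fintype.card Θ * √(B / Fintype.card F) := by
  have hF : (0 : ℝ) < Fintype.card F := by exact_mod_cast Fintype.card_pos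
  -- for fixed `θ` the regions met along `j ↦ τ j θ` are disjoint, so their `P θ`-masses sum to at most 1
  have h1 : ∀ θ, ∑ j, (P (τ j θ)).real (A (ℓ (τ j θ))) ≤ √(Fintype.card F * B) := by
    intro θ
    refine Real.le_sqrt_of_sq_le ?_
    have h2 : ∑ j, (P θ).real (A (ℓ (τ j θ))) ≤ 1 := by
      have h3 : Pairwise (Function.onFun Disjoint fun j => A (ℓ (τ j θ))) :=
        fun i j hij => hdisj fun h => hij (hinj θ h)
      rw [← measureReal_iUnion_fintype h3 fun j => hA _]
      exact measureReal_le_one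
    calc _ ≤ (Fintype.card F : ℝ) * ∑ j, (P (τ j θ)).real (A (ℓ (τ j θ))) ^ 2 := by
          simpa using sq_sum_le_card_mul_sum_sq (s := Finset.univ)
            (f := fun j => (P (τ j θ)).real (A (ℓ (τ j θ))))
      _ ≤ (Fintype.card F : ℝ) * ∑ j, B * (P θ).real (A (ℓ (τ j θ))) := by
          gcongr with j
          exact (h θ j).measureReal_sq_le hB (hA _)
      _ ≤ Fintype.card F * (B * 1) := by
          rw [← Finset.mul_sum]
          gcongr
      _ = _ := by ring
  have h3 : (Fintype.card F : ℝ) * ∑ θ, (P θ).real (A (ℓ θ))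
      ≤ Fintype.card Θ * √(Fintype.card F * B) := by
    calc _ = ∑ j : F, ∑ θ, (P (τ j θ)).real (A (ℓ (τ j θ))) := by
          simp_rw [fun j => Equiv.sum_comp (τ j) fun θ => (P θ).real (A (ℓ θ))]
          simp
      _ = ∑ θ, ∑ j : F, (P (τ j θ)).real (A (ℓ (τ j θ))) := Finset.sum_comm
      _ ≤ ∑ θ : Θ, √(Fintype.card F * B) := Finset.sum_le_sum fun θ _ => h1 θ
      _ = _ := by simp
  have h4 : √(Fintype.card F * B) = Fintype.card F * √(B / Fintype.card F) := by
    rw [← Real.sqrt_sq hF.le, ← Real.sqrt_mul (by positivity), Real.sqrt_sq hF.le]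
    congr 1
    field_simp
  rw [h4, mul_left_comm] at h3
  exact le_of_mul_le_mul_left h3 hF

/-- A loss that is at least `c i` on the failure of each decision `i`, up to the constant `d`, has an
expectation bounded below by the probabilities of failure. -/
theorem ofReal_le_lintegral_of_failure {I : Type*} [Fintype I] (P : Measure X)
    [IsProbabilityMeasure P] (A : I → Set X) (hA : ∀ i, MeasurableSet (A i)) (c : I → ℝ) (d : ℝ)
    (g : X → ℝ) (hg : ∀ x, ∑ i, c i * (A i)ᶜ.indicator 1 x - d ≤ g x) :
    ENNReal.ofReal (∑ i, c i * (1 - P.real (A i)) - d) ≤ ∫⁻ x, ENNReal.ofReal (g x) ∂P := by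
  set f : X → ℝ := fun x => ∑ i, c i * (A i)ᶜ.indicator 1 x - d with hf
  have hi : ∀ i, Integrable (fun x => c i * (A i)ᶜ.indicator (1 : X → ℝ) x) P := fun i =>
    ((integrable_const (1 : ℝ)).indicator (hA i).compl).const_mul _
  have hfi : Integrable f P :=
    (integrable_finsetSum _ fun i _ => hi i).sub (integrable_const d)
  have hint : ∫ x, f x ∂P = ∑ i, c i * (1 - P.real (A i)) - d := by
    rw [hf, integral_sub (integrable_finsetSum _ fun i _ => hi i) (integrable_const d),
      integral_finsetSum _ fun i _ => hi i]
    simp only [integral_const_mul, integral_const, probReal_univ, one_smul]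
    congr 1
    refine Finset.sum_congr rfl fun i _ => ?_
    rw [integral_indicator_one (hA i).compl, probReal_compl_eq_one_sub (hA i)]
  calc _ = ENNReal.ofReal (∫ x, f x ∂P) := by rw [hint]
    _ ≤ ENNReal.ofReal (∫ x, max (f x) 0 ∂P) :=
        ENNReal.ofReal_le_ofReal (integral_mono hfi hfi.pos_part fun x => le_max_left _ _)
    _ = ∫⁻ x, ENNReal.ofReal (max (f x) 0) ∂P :=
        ofReal_integral_eq_lintegral_ofReal hfi.pos_part
          (Eventually.of_forall fun x => le_max_right _ _)
    _ ≤ _ := lintegral_mono fun x => by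
        rw [ENNReal.ofReal_max]
        simpa using ENNReal.ofReal_le_ofReal (hg x)

end Testing

/-- The maximal risk is at least the average risk over a finite family of parameters. -/
theorem ofReal_le_minimaxRisk {M p : ℕ} {n : Fin M → ℕ} {μ : Fin M → EuclideanSpace ℝ (Fin p)}
    {L : MatTuple M p → MatTuple M p → Matrix (Fin p) (Fin p) ℝ} {C : Set (MatTuple M p)}
    {Θ : Type*} [Fintype Θ] [Nonempty Θ] {Ω : Θ → MatTuple M p} (hΩ : ∀ θ, Ω θ ∈ C) {V : ℝ}
    (h : ∀ T : Estimator n p, ∃ v : Θ → ℝ,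
      (∀ θ, ENNReal.ofReal (v θ) ≤ risk n μ L T (Ω θ)) ∧ Fintype.card Θ * V ≤ ∑ θ, v θ) :
    ENNReal.ofReal V ≤ minimaxRisk n μ L C := by
  refine le_iInf fun T => ?_
  obtain ⟨v, hv, hs⟩ := h T
  obtain ⟨θ, -, hθ⟩ : ∃ θ ∈ (Finset.univ : Finset Θ), V ≤ v θ :=
    Finset.exists_le_of_sum_le Finset.univ_nonempty (by simpa using hs)
  exact (ENNReal.ofReal_le_ofReal hθ).trans ((hv θ).trans (le_iSup₂_of_le (Ω θ) (hΩ θ) le_rfl))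

section Loss

variable {M p : ℕ} (n : Fin M → ℕ)

theorem wnorm₁_nonneg (a : Fin M → ℝ) : 0 ≤ wnorm₁ n a := by unfold wnorm₁; positivity

theorem wnorm₁_sub_le (a b : Fin M → ℝ) :
    wnorm₁ n (fun m => a m - b m) ≤ wnorm₁ n a + wnorm₁ n b := by
  unfold wnorm₁
  rw [← mul_add, ← Finset.sum_add_distrib]
  gcongr with m
  rw [← mul_add]
  gcongr
  exact abs_sub _ _

theorem wnorm₁_mul_const (a : Fin M → ℝ) {x : ℝ} (hx : 0 ≤ x) :
    wnorm₁ n (fun m => a m * x) = wnorm₁ n a * x := by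
  unfold wnorm₁
  rw [mul_assoc, Finset.sum_mul]
  simp only [abs_mul, abs_of_nonneg hx, mul_assoc]

theorem wnorm₁_le_wnorm₂ (a : Fin M → ℝ) : wnorm₁ n a ≤ wnorm₂ n a := by
  unfold wnorm₁ wnorm₂
  refine Real.le_sqrt_of_sq_le ?_
  rcases Nat.eq_zero_or_pos (totalSize n) with h0 | h0
  · simp [h0]
  have hN : (0 : ℝ) < totalSize n := by exact_mod_cast h0
  have h1 : (∑ m, (n m : ℝ) * |a m|) ^ 2 ≤ (∑ m, (n m : ℝ)) * ∑ m, (n m : ℝ) * a m ^ 2 := by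
    refine Finset.sum_sq_le_sum_mul_sum_of_sq_le_mul _ (fun m _ => by positivity)
      (fun m _ => by positivity) fun m _ => le_of_eq ?_
    rw [mul_pow, sq_abs]
    ring
  have h2 : ∑ m, (n m : ℝ) = totalSize n := by simp [totalSize]
  rw [h2] at h1
  calc _ = (1 / (totalSize n : ℝ)) ^ 2 * (∑ m, (n m : ℝ) * |a m|) ^ 2 := by ring
    _ ≤ (1 / (totalSize n : ℝ)) ^ 2 * (totalSize n * ∑ m, (n m : ℝ) * a m ^ 2) := by gcongr
    _ = _ := by field_simp

theorem frobNorm_sq (A : Matrix (Fin p) (Fin p) ℝ) : frobNorm A ^ 2 = ∑ j, ∑ k, A j k ^ 2 :=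
  Real.sq_sqrt (by positivity)

theorem lossMat₁_sq {r : ℝ} (A B : MatTuple M p) (j k : Fin p) :
    lossMat₁ n r A B j k ^ 2 = wnorm₁ n (fun m => A m j k - B m j k) ^ (2 * r) := by
  rw [lossMat₁, Matrix.of_apply, ← Real.rpow_natCast, ← Real.rpow_mul (wnorm₁_nonneg n _)]
  congr 1
  push_cast
  ring

theorem minimaxRisk_lossMat₁_le_lossMat₂ (μ : Fin M → EuclideanSpace ℝ (Fin p)) {r : ℝ}
    (hr : 0 ≤ r) (C : Set (MatTuple M p)) :
    minimaxRisk n μ (lossMat₁ n r) C ≤ minimaxRisk n μ (lossMat₂ n r) C := by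
  refine iInf_mono fun T => iSup₂_mono fun Ω _ => lintegral_mono fun X => ?_
  refine ENNReal.ofReal_le_ofReal ?_
  rw [frobNorm_sq, frobNorm_sq]
  gcongr with j _ k
  · exact Real.rpow_nonneg (wnorm₁_nonneg n _) r
  · exact Real.rpow_le_rpow (wnorm₁_nonneg n _) (wnorm₁_le_wnorm₂ n _) hr

end Loss

/-! ### Sparse precision matrices built from permutations -/

section QuadraticForm

variable {ι : Type*} [Fintype ι]

/-- A symmetric matrix whose columns have absolute sums at most `δ` has its quadratic form bounded
by `δ` times the squared Euclidean norm. -/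
theorem abs_dotProduct_mulVec_le {E : Matrix ι ι ℝ} (hE : E.transpose = E) {δ : ℝ}
    (h : ∀ k, ∑ j, |E j k| ≤ δ) (x : ι → ℝ) : |x ⬝ᵥ E.mulVec x| ≤ δ * (x ⬝ᵥ x) := by
  have hs : ∀ j k, E j k = E k j := fun j k => congrFun (congrFun hE.symm j) k
  -- `|x j| |x k| ≤ (x j ^ 2 + x k ^ 2) / 2`
  have h1 : |x ⬝ᵥ E.mulVec x| ≤ ∑ j, ∑ k, |E j k| * ((x j ^ 2 + x k ^ 2) / 2) := by
    simp only [dotProduct, Matrix.mulVec, Finset.mul_sum]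
    refine (Finset.abs_sum_le_sum_abs _ _).trans (Finset.sum_le_sum fun j _ => ?_)
    refine (Finset.abs_sum_le_sum_abs _ _).trans (Finset.sum_le_sum fun k _ => ?_)
    rw [mul_left_comm, abs_mul, abs_mul]
    gcongr
    nlinarith [sq_nonneg (|x j| - |x k|), sq_abs (x j), sq_abs (x k)]
  have h2 : ∑ j, ∑ k, |E j k| * ((x j ^ 2 + x k ^ 2) / 2) = ∑ k, (∑ j, |E j k|) * x k ^ 2 := by
    have h3 : ∑ j, ∑ k, |E j k| * (x j ^ 2 / 2) = ∑ k, ∑ j, |E j k| * (x k ^ 2 / 2) :=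
      Finset.sum_congr rfl fun j _ => Finset.sum_congr rfl fun k _ => by rw [hs]
    simp_rw [add_div, mul_add, Finset.sum_add_distrib]
    rw [h3, Finset.sum_comm (f := fun j k => |E j k| * (x k ^ 2 / 2)), ← Finset.sum_add_distrib]
    refine Finset.sum_congr rfl fun k _ => ?_
    rw [← Finset.sum_add_distrib, Finset.sum_mul]
    exact Finset.sum_congr rfl fun j _ => by ring
  rw [h2] at h1
  refine h1.trans ?_
  rw [dotProduct, Finset.mul_sum]
  refine Finset.sum_le_sum fun k _ => ?_
  rw [← pow_two]
  gcongr
  exact h k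

theorem posDef_of_le_dotProduct {S : Matrix ι ι ℝ} (hS : S.transpose = S) {b : ℝ} (hb : 0 < b)
    (h : ∀ x : ι → ℝ, b * (x ⬝ᵥ x) ≤ x ⬝ᵥ S.mulVec x) : S.PosDef := by
  refine Matrix.PosDef.of_dotProduct_mulVec_pos (by simpa [Matrix.IsHermitian] using hS)
    fun x hx => ?_
  have h0 : 0 < x ⬝ᵥ x := by
    refine lt_of_le_of_ne (Finset.sum_nonneg fun i _ => mul_self_nonneg _) fun h => hx ?_
    exact dotProduct_self_eq_zero.1 h.symm
  have := h x
  simp only [star_trivial]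
  nlinarith [mul_pos hb h0]

/-- If `S ≤ c` as a quadratic form, then the eigenvalues of `S⁻¹` are at least `c⁻¹`. -/
theorem le_of_mem_spectrum_inv [DecidableEq ι] {S : Matrix ι ι ℝ} (hS : S.PosDef) {c : ℝ} (hc : 0 < c)
    (h : ∀ x : ι → ℝ, x ⬝ᵥ S.mulVec x ≤ c * (x ⬝ᵥ x)) {z : ℝ} (hz : z ∈ spectrum ℝ S⁻¹) :
    c⁻¹ ≤ z := by
  have h1 : z ∈ spectrum ℝ (Matrix.toLin' S⁻¹) := by rwa [Matrix.spectrum_toLin']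
  obtain ⟨v, hv⟩ := (Module.End.hasEigenvalue_iff_mem_spectrum.2 h1).exists_hasEigenvector
  have h2 : S⁻¹.mulVec v = z • v := by simpa using hv.apply_eq_smul
  have h3 : v = z • S.mulVec v := by
    rw [← Matrix.mulVec_smul, ← h2, Matrix.mulVec_mulVec,
      Matrix.mul_nonsing_inv _ hS.det_pos.ne'.isUnit, Matrix.one_mulVec]
  have h0 : 0 < v ⬝ᵥ v := by
    refine lt_of_le_of_ne (Finset.sum_nonneg fun i _ => mul_self_nonneg _) fun h => hv.2 ?_
    exact dotProduct_self_eq_zero.1 h.symm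
  have h4 : v ⬝ᵥ v = z * (v ⬝ᵥ S.mulVec v) := by
    calc v ⬝ᵥ v = (z • S.mulVec v) ⬝ᵥ v := by rw [← h3]
      _ = _ := by rw [smul_dotProduct, dotProduct_comm, smul_eq_mul]
  have h5 : 0 < v ⬝ᵥ S.mulVec v := by
    have := hS.dotProduct_mulVec_pos hv.2
    simpa using this
  have hz0 : 0 < z := by
    by_contra hneg
    push Not at hneg
    nlinarith
  rw [inv_le_iff_one_le_mul₀ hc]
  have h6 := h v
  have h7 : v ⬝ᵥ v ≤ z * (c * (v ⬝ᵥ v)) := h4.trans_le (mul_le_mul_of_nonneg_left h6 hz0.le)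
  nlinarith

theorem inv_diag_le [DecidableEq ι] {S : Matrix ι ι ℝ} (hS : S.PosDef) {b : ℝ} (hb : 0 < b)
    (h : ∀ x : ι → ℝ, b * (x ⬝ᵥ x) ≤ x ⬝ᵥ S.mulVec x) (j : ι) : S⁻¹ j j ≤ b⁻¹ := by
  simpa using dotProduct_inv_mulVec_le hS hb h (Pi.single j 1)

end QuadraticForm

section Bipartite

/-- The `(s q) × (s q)` matrix made of `s × s` blocks, the block `(h, g)` being the matrix of the
permutation `π h g` of `Fin q` with its rows weighted by `v h g`. -/
def permBlocks {s q : ℕ} (π : Fin s → Fin s → Equiv.Perm (Fin q))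
    (v : Fin s → Fin s → Fin q → ℝ) : Matrix (Fin s × Fin q) (Fin s × Fin q) ℝ :=
  Matrix.of fun x y => if π x.1 y.1 x.2 = y.2 then v x.1 y.1 x.2 else 0

variable {U R : Type*} {p : ℕ} (e : Fin p ≃ (U ⊕ U) ⊕ R)

/-- The symmetric matrix in which `B` couples the first copy of `U` to the second one. The vertices in
`R` stay isolated. -/
def bipartite (B : Matrix U U ℝ) : Matrix (Fin p) (Fin p) ℝ :=
  (Matrix.fromBlocks (Matrix.fromBlocks 0 B B.transpose 0) 0 0 0 :
    Matrix ((U ⊕ U) ⊕ R) ((U ⊕ U) ⊕ R) ℝ).submatrix e e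

theorem bipartite_transpose (B : Matrix U U ℝ) : (bipartite e B).transpose = bipartite e B := by
  simp [bipartite, Matrix.transpose_submatrix, Matrix.fromBlocks_transpose]

theorem bipartite_sub (B B' : Matrix U U ℝ) :
    bipartite e B - bipartite e B' = bipartite e (B - B') := by
  ext j k
  simp only [bipartite, Matrix.sub_apply, Matrix.submatrix_apply]
  rcases e j with (x | x) | x <;> rcases e k with (y | y) | y <;> simp

theorem bipartite_apply (B : Matrix U U ℝ) (x y : U) :
    bipartite e B (e.symm (.inl (.inl x))) (e.symm (.inl (.inr y))) = B x y := by
  simp [bipartite]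

theorem bipartite_diag (B : Matrix U U ℝ) (k : Fin p) : bipartite e B k k = 0 := by
  simp only [bipartite, Matrix.submatrix_apply]
  rcases e k with (y | y) | y <;> simp

theorem sum_bipartite_sq [Fintype U] [Fintype R] (B : Matrix U U ℝ) :
    ∑ j, ∑ k, bipartite e B j k ^ 2 = 2 * ∑ x, ∑ y, B x y ^ 2 := by
  simp only [bipartite, Matrix.submatrix_apply]
  rw [Equiv.sum_comp e fun j => ∑ k, Matrix.fromBlocks (Matrix.fromBlocks 0 B B.transpose 0)
    (0 : Matrix (U ⊕ U) R ℝ) 0 0 j (e k) ^ 2]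
  simp_rw [fun j => Equiv.sum_comp e fun k => Matrix.fromBlocks (Matrix.fromBlocks 0 B B.transpose 0)
    (0 : Matrix (U ⊕ U) R ℝ) 0 0 j k ^ 2]
  simp only [Fintype.sum_sum_type, Matrix.fromBlocks_apply₁₁, Matrix.fromBlocks_apply₁₂,
    Matrix.fromBlocks_apply₂₁, Matrix.fromBlocks_apply₂₂, Matrix.zero_apply,
    Matrix.transpose_apply]
  have h : ∑ y, ∑ x, B x y ^ 2 = ∑ x, ∑ y, B x y ^ 2 := Finset.sum_comm
  simp [h]
  ring

/-- A sum over all pairs of vertices is at least its part over the couplable pairs, each of which is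
counted in one order only. -/
theorem sum_sum_le_sum_univ [Fintype U] [Fintype R] (F : Fin p → Fin p → ℝ)
    (hF : ∀ j k, 0 ≤ F j k) :
    ∑ x, ∑ y, F (e.symm (.inl (.inl x))) (e.symm (.inl (.inr y))) ≤ ∑ j, ∑ k, F j k := by
  rw [← Equiv.sum_comp e.symm fun j => ∑ k, F j k]
  simp_rw [fun j => (Equiv.sum_comp e.symm fun k => F j k).symm, Fintype.sum_sum_type]
  have h : ∀ j (f : U → U ⊕ U), 0 ≤ ∑ x, F j (e.symm (.inl (f x))) :=
    fun j f => Finset.sum_nonneg fun _ _ => hF _ _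
  have h' : ∀ j (f : R → (U ⊕ U) ⊕ R), 0 ≤ ∑ x, F j (e.symm (f x)) :=
    fun j f => Finset.sum_nonneg fun _ _ => hF _ _
  rw [add_assoc]
  refine (Finset.sum_le_sum fun x _ => ?_).trans (le_add_of_nonneg_right ?_)
  · linarith [h (e.symm (.inl (.inl x))) Sum.inl, h' (e.symm (.inl (.inl x))) Sum.inr]
  · refine add_nonneg ?_ ?_ <;> refine Finset.sum_nonneg fun x _ => ?_ <;>
      exact add_nonneg (add_nonneg (h _ _) (h _ _)) (h' _ _)

variable {s q : ℕ} (e : Fin p ≃ ((Fin s × Fin q) ⊕ (Fin s × Fin q)) ⊕ R)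
  (π : Fin s → Fin s → Equiv.Perm (Fin q))

/-- Every column of `bipartite e (permBlocks π v)` is supported on `s` rows, whatever `v`. -/
theorem exists_range_of_bipartite_ne_zero (k : Fin p) :
    ∃ f : Fin s → Fin p, ∀ v j, bipartite e (permBlocks π v) j k ≠ 0 → j ∈ Set.range f := by
  obtain ⟨k, rfl⟩ := e.symm.surjective k
  rcases k with (⟨h, i⟩ | ⟨g, i⟩) | k
  · refine ⟨fun g => e.symm (.inl (.inr (g, π h g i))), fun v j => ?_⟩
    obtain ⟨j, rfl⟩ := e.symm.surjective j
    rcases j with (⟨h', i'⟩ | ⟨g', i'⟩) | j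
    · simp [bipartite]
    · simp only [bipartite, Matrix.submatrix_apply, Equiv.apply_symm_apply, permBlocks]
      simp +contextual
    · simp [bipartite]
  · refine ⟨fun h => e.symm (.inl (.inl (h, (π h g).symm i))), fun v j => ?_⟩
    obtain ⟨j, rfl⟩ := e.symm.surjective j
    rcases j with (⟨h', i'⟩ | ⟨g', i'⟩) | j
    · simp only [bipartite, Matrix.submatrix_apply, Equiv.apply_symm_apply, permBlocks]
      simp only [Matrix.fromBlocks_apply₁₁, Matrix.fromBlocks_apply₁₂, Matrix.of_apply, ne_eq,
        ite_eq_right_iff, not_forall, Set.mem_range, EmbeddingLike.apply_eq_iff_eq,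
        Sum.inl.injEq, Prod.mk.injEq]
      rintro ⟨h1, -⟩
      exact ⟨h', rfl, by rw [← h1]; simp⟩
    · simp [bipartite]
    · simp [bipartite]
  · refine ⟨fun _ => e.symm (.inr k), fun v j => ?_⟩
    obtain ⟨j, rfl⟩ := e.symm.surjective j
    rcases j with (⟨h', i'⟩ | ⟨g', i'⟩) | j <;> simp [bipartite]

theorem abs_bipartite_permBlocks_le {v : Fin s → Fin s → Fin q → ℝ} {δ : ℝ} (hδ : 0 ≤ δ)
    (hv : ∀ h g i, |v h g i| ≤ δ) (j k : Fin p) : |bipartite e (permBlocks π v) j k| ≤ δ := by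
  have h1 : ∀ x y, |permBlocks π v x y| ≤ δ := by
    intro x y
    simp only [permBlocks, Matrix.of_apply]
    split_ifs
    · exact hv _ _ _
    · simpa using hδ
  simp only [bipartite, Matrix.submatrix_apply]
  rcases e j with (x | x) | x <;> rcases e k with (y | y) | y <;> simp [h1, hδ]

theorem sum_abs_bipartite_le {v : Fin s → Fin s → Fin q → ℝ} {δ : ℝ} (hδ : 0 ≤ δ)
    (hv : ∀ h g i, |v h g i| ≤ δ) (k : Fin p) :
    ∑ j, |bipartite e (permBlocks π v) j k| ≤ s * δ := by
  obtain ⟨f, hf⟩ := exists_range_of_bipartite_ne_zero e π k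
  have h1 : ∑ j, |bipartite e (permBlocks π v) j k|
      = ∑ j ∈ Finset.univ.image f, |bipartite e (permBlocks π v) j k| := by
    symm
    refine Finset.sum_subset (Finset.subset_univ _) fun j _ hj => ?_
    by_contra h
    refine hj ?_
    obtain ⟨i, hi⟩ := hf v j (fun h0 => h (by rw [h0, abs_zero]))
    exact Finset.mem_image.2 ⟨i, Finset.mem_univ _, hi⟩
  rw [h1]
  calc _ ≤ ∑ j ∈ Finset.univ.image f, δ :=
        Finset.sum_le_sum fun j _ => abs_bipartite_permBlocks_le e π hδ hv j k
    _ = ((Finset.univ.image f).card : ℝ) * δ := by simp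
    _ ≤ s * δ := by
        gcongr
        simpa using Finset.card_image_le (s := Finset.univ) (f := f)

end Bipartite

section PrecisionTuple

variable {R : Type*} {M p s q : ℕ}
  (e : Fin p ≃ ((Fin s × Fin q) ⊕ (Fin s × Fin q)) ⊕ R)

/-- The tuple of precision matrices `a I + E`, where `E` is the bipartite matrix with coupling
`permBlocks π (v m)` at site `m`. -/
def precisionTuple (a : ℝ) (π : Fin s → Fin s → Equiv.Perm (Fin q))
    (v : Fin M → Fin s → Fin s → Fin q → ℝ) : MatTuple M p :=
  fun m => a • 1 + bipartite e (permBlocks π (v m))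

variable {a δ : ℝ} (π : Fin s → Fin s → Equiv.Perm (Fin q))
  (v : Fin M → Fin s → Fin s → Fin q → ℝ)

theorem precisionTuple_apply_inl_inr (m : Fin M) (x y : Fin s × Fin q) :
    precisionTuple e a π v m (e.symm (.inl (.inl x))) (e.symm (.inl (.inr y)))
      = permBlocks π (v m) x y := by
  rw [precisionTuple, Matrix.add_apply, bipartite_apply, Matrix.smul_apply, Matrix.one_apply_ne]
  · simp
  · simp

theorem precisionTuple_transpose (m : Fin M) :
    (precisionTuple e a π v m).transpose = precisionTuple e a π v m := by
  simp [precisionTuple, bipartite_transpose]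

variable {π v}

theorem abs_bipartite_form_le (hδ : 0 ≤ δ) (hv : ∀ m h g i, |v m h g i| ≤ δ) (m : Fin M)
    (x : Fin p → ℝ) :
    |x ⬝ᵥ (bipartite e (permBlocks π (v m))).mulVec x| ≤ s * δ * (x ⬝ᵥ x) :=
  abs_dotProduct_mulVec_le (bipartite_transpose e _) (sum_abs_bipartite_le e π hδ (hv m)) x

theorem precisionTuple_form (m : Fin M) (x : Fin p → ℝ) :
    x ⬝ᵥ (precisionTuple e a π v m).mulVec x
      = a * (x ⬝ᵥ x) + x ⬝ᵥ (bipartite e (permBlocks π (v m))).mulVec x := by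
  simp [precisionTuple, Matrix.add_mulVec, dotProduct_add, Matrix.smul_mulVec]

theorem precisionTuple_form_ge (hδ : 0 ≤ δ) (hv : ∀ m h g i, |v m h g i| ≤ δ) (m : Fin M)
    (x : Fin p → ℝ) :
    (a - s * δ) * (x ⬝ᵥ x) ≤ x ⬝ᵥ (precisionTuple e a π v m).mulVec x := by
  rw [precisionTuple_form]
  linarith [(abs_le.1 (abs_bipartite_form_le (π := π) e hδ hv m x)).1]

theorem precisionTuple_form_le (hδ : 0 ≤ δ) (hv : ∀ m h g i, |v m h g i| ≤ δ) (m : Fin M)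
    (x : Fin p → ℝ) :
    x ⬝ᵥ (precisionTuple e a π v m).mulVec x ≤ (a + s * δ) * (x ⬝ᵥ x) := by
  rw [precisionTuple_form]
  linarith [(abs_le.1 (abs_bipartite_form_le (π := π) e hδ hv m x)).2]

theorem precisionTuple_posDef (hδ : 0 ≤ δ) (hv : ∀ m h g i, |v m h g i| ≤ δ) (hsa : s * δ < a)
    (m : Fin M) : (precisionTuple e a π v m).PosDef :=
  posDef_of_le_dotProduct (precisionTuple_transpose e π v m) (by linarith)
    (precisionTuple_form_ge e hδ hv m)

theorem precisionTuple_mem_regularClass {Cmin Cmax : ℝ} (hδ : 0 ≤ δ)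
    (hv : ∀ m h g i, |v m h g i| ≤ δ) (hsa : s * δ < a) (hmin : Cmin ≤ (a + s * δ)⁻¹)
    (hmax : (a - s * δ)⁻¹ ≤ Cmax) : precisionTuple e a π v ∈ regularClass M p Cmin Cmax := by
  have hs : 0 ≤ s * δ := by positivity
  refine fun m => ⟨fun z hz => hmin.trans ?_, fun j => le_trans ?_ hmax⟩
  · exact le_of_mem_spectrum_inv (precisionTuple_posDef e hδ hv hsa m) (by linarith)
      (precisionTuple_form_le e hδ hv m) hz
  · exact inv_diag_le (precisionTuple_posDef e hδ hv hsa m) (by linarith)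
      (precisionTuple_form_ge e hδ hv m) j

theorem precisionTuple_apply_of_ne (m : Fin M) {j k : Fin p} (hjk : j ≠ k) :
    precisionTuple e a π v m j k = bipartite e (permBlocks π (v m)) j k := by
  simp [precisionTuple, Matrix.one_apply_ne hjk]

theorem precisionTuple_apply_self (m : Fin M) (k : Fin p) : precisionTuple e a π v m k k = a := by
  simp [precisionTuple, bipartite_diag]

theorem heteroSupport_ncard_le (k : Fin p) :
    (heteroSupport (precisionTuple e a π v) k).ncard ≤ s := by
  obtain ⟨f, hf⟩ := exists_range_of_bipartite_ne_zero e π k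
  have h1 : heteroSupport (precisionTuple e a π v) k ⊆ f '' Set.univ := by
    intro j hj
    rw [Set.image_univ]
    by_contra hn
    have hb : ∀ m, bipartite e (permBlocks π (v m)) j k = 0 := fun m => by
      by_contra h0
      exact hn (hf _ _ h0)
    refine hj fun m m' => ?_
    by_cases hjk : j = k
    · rw [hjk, precisionTuple_apply_self, precisionTuple_apply_self]
    · rw [precisionTuple_apply_of_ne e m hjk, precisionTuple_apply_of_ne e m' hjk, hb, hb]
  calc _ ≤ (f '' Set.univ).ncard := Set.ncard_le_ncard h1 (Set.toFinite _)
    _ ≤ (Set.univ : Set (Fin s)).ncard := Set.ncard_image_le (Set.toFinite _)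
    _ = s := by simp

/-- If all sites have the same couplings, a column has at most `s` common off-diagonal entries and its
diagonal entry, hence the condition `s + 1 ≤ s₁`. -/
theorem precisionTuple_mem_sparseClass_of_common {s₁ s₂ : ℕ} (hδ : 0 ≤ δ)
    (hv : ∀ m h g i, |v m h g i| ≤ δ) (hsa : s * δ < a) (hM : 0 < M) (hs : s + 1 ≤ s₁)
    (hcommon : ∀ m m', v m = v m') : precisionTuple e a π v ∈ sparseClass M p s₁ s₂ := by
  refine ⟨precisionTuple_posDef e hδ hv hsa, fun k => ?_, fun k => ?_⟩
  · obtain ⟨f, hf⟩ := exists_range_of_bipartite_ne_zero e π k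
    have h1 : commonSupport (precisionTuple e a π v) k ⊆ insert k (f '' Set.univ) := by
      rintro j ⟨-, hj⟩
      rw [Set.image_univ, Set.mem_insert_iff]
      by_cases hjk : j = k
      · exact Or.inl hjk
      · have := hj ⟨0, hM⟩
        rw [precisionTuple_apply_of_ne e _ hjk] at this
        exact Or.inr (hf _ _ this)
    calc _ ≤ (insert k (f '' Set.univ)).ncard := Set.ncard_le_ncard h1 (Set.toFinite _)
      _ ≤ (f '' Set.univ).ncard + 1 := Set.ncard_insert_le _ _
      _ ≤ (Set.univ : Set (Fin s)).ncard + 1 := by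
          gcongr
          exact Set.ncard_image_le (Set.toFinite _)
      _ ≤ s₁ := by simpa using hs
  · have : heteroSupport (precisionTuple e a π v) k = ∅ := by
      refine Set.eq_empty_of_forall_notMem fun j hj => hj fun m m' => ?_
      simp only [precisionTuple, hcommon m m']
    simp [this]

/-- If one site has no couplings, the only common entry of a column is the diagonal one: an entry
shared by all sites off the diagonal vanishes. -/
theorem precisionTuple_mem_sparseClass_of_eq_zero {s₁ s₂ : ℕ} (hδ : 0 ≤ δ)
    (hv : ∀ m h g i, |v m h g i| ≤ δ) (hsa : s * δ < a) (hs₁ : 1 ≤ s₁) (hs : s ≤ s₂)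
    {m₀ : Fin M} (h0 : v m₀ = 0) : precisionTuple e a π v ∈ sparseClass M p s₁ s₂ := by
  refine ⟨precisionTuple_posDef e hδ hv hsa, fun k => ?_,
    fun k => (heteroSupport_ncard_le e k).trans hs⟩
  have h1 : commonSupport (precisionTuple e a π v) k ⊆ {k} := by
    rintro j ⟨-, hj⟩
    by_contra hjk
    refine hj m₀ ?_
    rw [precisionTuple_apply_of_ne e m₀ hjk, h0]
    have : permBlocks π (0 : Fin s → Fin s → Fin q → ℝ) = 0 := by
      ext x y
      simp [permBlocks]
    rw [this]
    simp only [bipartite, Matrix.submatrix_apply]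
    rcases e j with (x | x) | x <;> rcases e k with (y | y) | y <;> simp
  calc _ ≤ ({k} : Set (Fin p)).ncard := Set.ncard_le_ncard h1 (Set.toFinite _)
    _ ≤ s₁ := by simpa using hs₁

/-- Two nearby tuples of the family have laws with a bounded `χ²`-divergence, controlled by the
squared distance of their couplings. -/
theorem secondMomentBound_precisionTuple [Fintype R] (n : Fin M → ℕ) (μ : Fin M → EuclideanSpace ℝ (Fin p))
    {π' : Fin s → Fin s → Equiv.Perm (Fin q)} {v' : Fin M → Fin s → Fin s → Fin q → ℝ}
    (ha : 0 < a) (hs : 1 ≤ s) (hδ : 0 ≤ δ) (hv : ∀ m h g i, |v m h g i| ≤ δ)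
    (hv' : ∀ m h g i, |v' m h g i| ≤ δ) (hsa : s * δ ≤ a / 16) {f : Fin M → ℝ}
    (hf : ∀ m, ∑ x, ∑ y, (permBlocks π' (v' m) - permBlocks π (v m)) x y ^ 2 ≤ f m)
    (hfδ : ∀ m, f m ≤ 4 * δ ^ 2) :
    SecondMomentBound (dataLaw n μ (precisionTuple e a π' v')) (dataLaw n μ (precisionTuple e a π v))
      (ENNReal.ofReal (Real.exp (8 / a ^ 2 * ∑ m, n m * f m))) := by
  set D : MatTuple M p := fun m => bipartite e (permBlocks π' (v' m) - permBlocks π (v m)) with hD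
  have hDsub : ∀ m, precisionTuple e a π' v' m - D m = precisionTuple e a π v m := by
    intro m
    simp only [precisionTuple, hD, ← bipartite_sub]
    abel
  have hδa : δ ≤ a / 16 := by
    have : (1 : ℝ) ≤ s := by exact_mod_cast hs
    nlinarith
  have hb : 0 < a / 2 := by positivity
  have hDsq : ∀ m, ∑ i, ∑ j, D m i j ^ 2 ≤ 2 * f m := fun m => by
    rw [hD, sum_bipartite_sq]
    linarith [hf m]
  have hform : ∀ m, ∀ x : Fin p → ℝ,
      a / 2 * (x ⬝ᵥ x) ≤ x ⬝ᵥ (precisionTuple e a π' v' m).mulVec x := fun m x => by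
    have h0 : 0 ≤ x ⬝ᵥ x := Finset.sum_nonneg fun i _ => mul_self_nonneg _
    nlinarith [precisionTuple_form_ge (a := a) (π := π') e hδ hv' m x]
  -- the three matrices `S`, `S - D` and `S + D` are `a I` plus a form of size at most `3 s δ < a / 2`
  have key := secondMomentBound_dataLaw n μ (S := precisionTuple e a π' v') (D := D) hb
    (precisionTuple_posDef e hδ hv' (by linarith))
    (fun m => by rw [hDsub]; exact precisionTuple_posDef e hδ hv (by linarith) m)
    (fun m => by
      refine posDef_of_le_dotProduct (b := a / 2) ?_ hb fun x => ?_
      · rw [Matrix.transpose_add, precisionTuple_transpose, hD, bipartite_transpose]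
      · have h0 : 0 ≤ x ⬝ᵥ x := Finset.sum_nonneg fun i _ => mul_self_nonneg _
        have h1 := precisionTuple_form_ge (a := a) (π := π') e hδ hv' m x
        have h2 := (abs_le.1 (abs_bipartite_form_le (π := π') e hδ hv' m x)).1
        have h3 := (abs_le.1 (abs_bipartite_form_le (π := π) e hδ hv m x)).2
        simp only [hD, ← bipartite_sub, Matrix.add_mulVec, Matrix.sub_mulVec, dotProduct_add,
          dotProduct_sub]
        nlinarith)
    (fun m => bipartite_transpose e _) hform
    (fun m => by
      rw [div_le_iff₀ (by positivity)]
      nlinarith [hDsq m, hfδ m])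
  simp_rw [hDsub] at key
  refine key.mono (ENNReal.ofReal_le_ofReal (Real.exp_le_exp.2 ?_))
  rw [Finset.mul_sum]
  refine Finset.sum_le_sum fun m _ => ?_
  calc _ ≤ n m * (2 * f m / (a / 2) ^ 2) := by gcongr; exact hDsq m
    _ = _ := by field_simp; ring

end PrecisionTuple

/-! ### Couplings at unknown positions -/

instance isProbabilityMeasure_dataLaw {M p : ℕ} (n : Fin M → ℕ)
    (μ : Fin M → EuclideanSpace ℝ (Fin p)) (Ω : MatTuple M p) :
    IsProbabilityMeasure (dataLaw n μ Ω) := by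
  unfold dataLaw
  infer_instance

theorem measurable_wnorm₁ {X : Type*} [MeasurableSpace X] {M : ℕ} (n : Fin M → ℕ)
    {f : X → Fin M → ℝ} (hf : ∀ m, Measurable fun x => f x m) :
    Measurable fun x => wnorm₁ n (f x) := by
  unfold wnorm₁
  exact (Finset.measurable_sum _ fun m _ =>
    (continuous_abs.measurable.comp (hf m)).const_mul _).const_mul _

/-- Lower bound of the loss by its part on the couplings. -/
theorem sum_wnorm₁_rpow_le_frobNorm_sq {M p s q : ℕ} {R : Type*} [Fintype R]
    (e : Fin p ≃ ((Fin s × Fin q) ⊕ (Fin s × Fin q)) ⊕ R) (n : Fin M → ℕ) (r a : ℝ)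
    (π : Fin s → Fin s → Equiv.Perm (Fin q)) (v : Fin M → Fin s → Fin s → Fin q → ℝ)
    (A : MatTuple M p) :
    ∑ i : Fin s × Fin s × Fin q, ∑ j : Fin q,
      wnorm₁ n (fun m => A m (e.symm (.inl (.inl (i.1, i.2.2)))) (e.symm (.inl (.inr (i.2.1, j))))
        - permBlocks π (v m) (i.1, i.2.2) (i.2.1, j)) ^ (2 * r)
      ≤ frobNorm (lossMat₁ n r A (precisionTuple e a π v)) ^ 2 := by
  rw [frobNorm_sq]
  refine le_trans (le_of_eq ?_) (sum_sum_le_sum_univ e _ fun j k => sq_nonneg _)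
  simp only [lossMat₁_sq, precisionTuple_apply_inl_inr, Fintype.sum_prod_type]
  exact Finset.sum_congr rfl fun h _ => Finset.sum_comm

section Permutation

variable {s q : ℕ}

/-- The permutation of the parameter space which composes `π h g` with the transposition of `i`
and `j`. -/
def swapAt (h g : Fin s) (i j : Fin q) : Equiv.Perm (Fin s → Fin s → Equiv.Perm (Fin q)) :=
  Function.Involutive.toPerm
    (fun π h' g' => if h' = h ∧ g' = g then π h' g' * Equiv.swap i j else π h' g') fun π => by
      funext h' g'
      dsimp only
      split_ifs
      · rw [mul_assoc, Equiv.swap_mul_self, mul_one]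
      · rfl

theorem swapAt_apply (h g : Fin s) (i j : Fin q) (π : Fin s → Fin s → Equiv.Perm (Fin q))
    (h' g' : Fin s) : swapAt h g i j π h' g'
      = if h' = h ∧ g' = g then π h' g' * Equiv.swap i j else π h' g' := rfl

/-- A transposition in one block moves at most two ones, hence changes at most four entries. -/
theorem sum_permBlocks_swapAt_sub_sq_le (h g : Fin s) (i j : Fin q)
    (π : Fin s → Fin s → Equiv.Perm (Fin q)) (c : ℝ) :
    ∑ x, ∑ y, (permBlocks (swapAt h g i j π) (fun _ _ _ => c) - permBlocks π fun _ _ _ => c) x y ^ 2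
      ≤ 4 * c ^ 2 := by
  have hc := sq_nonneg c
  have key : ∀ h' i' g' j',
      (permBlocks (swapAt h g i j π) (fun _ _ _ => c) - permBlocks π fun _ _ _ => c)
        (h', i') (g', j') ^ 2
      ≤ (if h' = h then 1 else 0) * (((if i' = i then 1 else 0) + (if i' = j then 1 else 0)) *
        ((if g' = g then 1 else 0) * ((if swapAt h g i j π h' g' i' = j' then c ^ 2 else 0)
          + (if π h' g' i' = j' then c ^ 2 else 0)))) := by
    intro h' i' g' j'
    simp only [Matrix.sub_apply, permBlocks, Matrix.of_apply]
    by_cases hhg : h' = h ∧ g' = g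
    · obtain ⟨rfl, rfl⟩ := hhg
      by_cases hi : i' = i ∨ i' = j
      · have h1 : (1 : ℝ) ≤ (if i' = i then 1 else 0) + (if i' = j then 1 else 0) := by
          rcases hi with rfl | rfl <;> simp only [if_true] <;> split_ifs <;> norm_num
        have h2 : 0 ≤ (if swapAt h' g' i j π h' g' i' = j' then c ^ 2 else 0)
          + (if π h' g' i' = j' then c ^ 2 else 0) := by split_ifs <;> positivity
        simp only [if_true, one_mul]
        refine le_trans ?_ (le_mul_of_one_le_left h2 h1)
        split_ifs <;> (simp; try linarith)
      · push Not at hi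
        rw [swapAt_apply]
        simp only [and_self, if_true, Equiv.Perm.mul_apply,
          Equiv.swap_apply_of_ne_of_ne hi.1 hi.2, sub_self]
        simp [hi]
    · rw [swapAt_apply, if_neg hhg, sub_self]
      have : (0 : ℝ) ^ 2 = 0 := by norm_num
      rw [this]
      positivity
  simp only [Fintype.sum_prod_type]
  refine (Finset.sum_le_sum fun h' _ => Finset.sum_le_sum fun i' _ => Finset.sum_le_sum fun g' _ =>
    Finset.sum_le_sum fun j' _ => key h' i' g' j').trans (le_of_eq ?_)
  simp only [← Finset.mul_sum, Finset.sum_add_distrib, Finset.sum_ite_eq, Finset.sum_ite_eq',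
    Finset.mem_univ, if_true, ← Finset.sum_mul]
  ring

/-- Minimax lower bound over the uniform choice of the positions of the couplings: each of the `s² q`
couplings is misplaced with probability at least `1 / 2`, at the cost `(wnorm₁ n w * ε / 2) ^ (2 r)`. -/
theorem ofReal_le_minimaxRisk_of_permutations {M p : ℕ} {R : Type*} [Fintype R]
    (e : Fin p ≃ ((Fin s × Fin q) ⊕ (Fin s × Fin q)) ⊕ R) (n : Fin M → ℕ)
    (μ : Fin M → EuclideanSpace ℝ (Fin p)) {r a ε : ℝ} (hr : 0 < r) (ha : 0 < a) (hε : 0 ≤ ε)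
    {w : Fin M → ℝ} (hw0 : ∀ m, 0 ≤ w m) (hw1 : ∀ m, w m ≤ 1) (hs : 1 ≤ s) (hq : 1 ≤ q)
    (hsa : s * ε ≤ a / 16) (hexp : Real.exp (32 / a ^ 2 * (totalSize n * ε ^ 2)) ≤ q / 4)
    {C : Set (MatTuple M p)} (hC : ∀ π, precisionTuple e a π (fun m _ _ _ => w m * ε) ∈ C) :
    ENNReal.ofReal (1 / p * (s * s * q / 2 * (wnorm₁ n w * ε / 2) ^ (2 * r)))
      ≤ minimaxRisk n μ (lossMat₁ n r) C := by
  set v : Fin M → Fin s → Fin s → Fin q → ℝ := fun m _ _ _ => w m * ε with hvdef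
  have hv : ∀ m h g i, |v m h g i| ≤ ε := fun m h g i => by
    rw [hvdef, abs_of_nonneg (mul_nonneg (hw0 m) hε)]
    exact mul_le_of_le_one_left hε (hw1 m)
  have hq0 : (0 : ℝ) < q := by exact_mod_cast hq
  have : Nonempty (Fin q) := ⟨⟨0, hq⟩⟩
  set t := wnorm₁ n w * ε / 2 with ht
  have ht0 : 0 ≤ t := by have := wnorm₁_nonneg n w; positivity
  rcases ht0.eq_or_lt with ht1 | ht1
  · rw [← ht1, Real.zero_rpow (by positivity)]
    simp
  refine ofReal_le_minimaxRisk (Θ := Fin s → Fin s → Equiv.Perm (Fin q))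
    (Ω := fun π => precisionTuple e a π v) hC fun T => ?_
  -- `A i j` is the event that the estimator points at the position `j` for the coupling `i`: it is close
  -- to `w ε` there and close to `0` at all other positions
  let A : Fin s × Fin s × Fin q → Fin q → Set (Data n p) := fun i j =>
    {X | wnorm₁ n (fun m => T.1 X m (e.symm (.inl (.inl (i.1, i.2.2))))
        (e.symm (.inl (.inr (i.2.1, j)))) - w m * ε) < t ∧
      ∀ j', j' ≠ j → wnorm₁ n (fun m => T.1 X m (e.symm (.inl (.inl (i.1, i.2.2))))
        (e.symm (.inl (.inr (i.2.1, j'))))) < t}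
  have hA : ∀ i j, MeasurableSet (A i j) := by
    intro i j
    have hAeq : A i j = {X | wnorm₁ n (fun m => T.1 X m (e.symm (.inl (.inl (i.1, i.2.2))))
          (e.symm (.inl (.inr (i.2.1, j)))) - w m * ε) < t} ∩ ⋂ j', ⋂ (_ : j' ≠ j),
        {X | wnorm₁ n (fun m => T.1 X m (e.symm (.inl (.inl (i.1, i.2.2))))
          (e.symm (.inl (.inr (i.2.1, j'))))) < t} := by
      ext X
      simp only [A, Set.mem_inter_iff, Set.mem_iInter, Set.mem_ofPred_eq]
    rw [hAeq]
    refine MeasurableSet.inter (measurableSet_lt (measurable_wnorm₁ n fun m =>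
      (T.2 _ _ _).sub_const _) measurable_const) ?_
    exact MeasurableSet.iInter fun j' => MeasurableSet.iInter fun _ =>
      measurableSet_lt (measurable_wnorm₁ n fun m => T.2 _ _ _) measurable_const
  have hdisj : ∀ i, Pairwise (Function.onFun Disjoint (A i)) := by
    intro i j j' hjj
    refine Set.disjoint_left.2 fun X hX hX' => ?_
    have h1 := hX.1
    have h2 := hX'.2 j hjj
    have h3 := wnorm₁_sub_le n (fun m => T.1 X m (e.symm (.inl (.inl (i.1, i.2.2))))
        (e.symm (.inl (.inr (i.2.1, j))))) (fun m => T.1 X m (e.symm (.inl (.inl (i.1, i.2.2))))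
        (e.symm (.inl (.inr (i.2.1, j)))) - w m * ε)
    simp only [sub_sub_cancel] at h3
    rw [wnorm₁_mul_const n w hε] at h3
    linarith
  refine ⟨fun π => ∑ i : Fin s × Fin s × Fin q, 1 / p * t ^ (2 * r) *
    (1 - (dataLaw n μ (precisionTuple e a π v)).real (A i (π i.1 i.2.1 i.2.2))) - 0,
    fun π => ?_, ?_⟩
  · refine ofReal_le_lintegral_of_failure _ (fun i => A i (π i.1 i.2.1 i.2.2)) (fun i => hA _ _)
      (fun _ => 1 / p * t ^ (2 * r)) 0 _ fun X => ?_
    rw [sub_zero]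
    simp_rw [mul_assoc]
    rw [← Finset.mul_sum]
    refine mul_le_mul_of_nonneg_left ?_ (by positivity)
    refine le_trans (Finset.sum_le_sum fun i _ => ?_)
      (sum_wnorm₁_rpow_le_frobNorm_sq e n r a π v (T.1 X))
    have hnn : ∀ j ∈ (Finset.univ : Finset (Fin q)), 0 ≤
        wnorm₁ n (fun m => T.1 X m (e.symm (.inl (.inl (i.1, i.2.2))))
          (e.symm (.inl (.inr (i.2.1, j)))) - permBlocks π (v m) (i.1, i.2.2) (i.2.1, j))
            ^ (2 * r) := fun j _ => Real.rpow_nonneg (wnorm₁_nonneg n _) _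
    by_cases hX : X ∈ A i (π i.1 i.2.1 i.2.2)
    · rw [Set.indicator_of_notMem (by simpa using hX), mul_zero]
      exact Finset.sum_nonneg hnn
    · rw [Set.indicator_of_mem (by simpa using hX)]
      simp only [Pi.one_apply, mul_one]
      have hX' : ∃ j, t ≤ wnorm₁ n (fun m => T.1 X m (e.symm (.inl (.inl (i.1, i.2.2))))
          (e.symm (.inl (.inr (i.2.1, j)))) - permBlocks π (v m) (i.1, i.2.2) (i.2.1, j)) := by
        by_contra hcon
        push Not at hcon
        refine hX ⟨?_, fun j' hj' => ?_⟩
        · simpa [permBlocks, hvdef] using hcon (π i.1 i.2.1 i.2.2)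
        · simpa [permBlocks, hvdef, hj'.symm] using hcon j'
      obtain ⟨j, hj⟩ := hX'
      exact (Real.rpow_le_rpow ht0 hj (by positivity)).trans
        (Finset.single_le_sum hnn (Finset.mem_univ j))
  · simp only [sub_zero]
    rw [Finset.sum_comm]
    have hsucc : ∀ i : Fin s × Fin s × Fin q,
        ∑ π, (dataLaw n μ (precisionTuple e a π v)).real (A i (π i.1 i.2.1 i.2.2))
          ≤ Fintype.card (Fin s → Fin s → Equiv.Perm (Fin q)) * (1 / 2) := by
      intro i
      have h1 := sum_measureReal_success_le (fun π => dataLaw n μ (precisionTuple e a π v))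
        (fun j => swapAt i.1 i.2.1 i.2.2 j) (fun π => π i.1 i.2.1 i.2.2) (A i) (hA i) (hdisj i)
        (fun π j j' hjj => by
          simpa [swapAt_apply] using hjj)
        (B := q / 4) (by positivity)
        (fun π j => (secondMomentBound_precisionTuple (f := fun _ => 4 * ε ^ 2) e n μ ha hs hε hv
          hv hsa (fun m => (sum_permBlocks_swapAt_sub_sq_le _ _ _ _ π _).trans (by
            have := hw0 m
            have := hw1 m
            gcongr
            exact mul_le_of_le_one_left hε (hw1 m))) fun m => le_rfl).mono
          (ENNReal.ofReal_le_ofReal (le_trans (le_of_eq ?_) hexp)))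
      · have h2 : √((q : ℝ) / 4 / Fintype.card (Fin q)) = 1 / 2 := by
          rw [Fintype.card_fin, div_right_comm, div_self hq0.ne',
            show (1 / 4 : ℝ) = (1 / 2) ^ 2 by norm_num, Real.sqrt_sq (by norm_num)]
        rwa [h2] at h1
      · rw [← Finset.sum_mul]
        simp only [totalSize, Nat.cast_sum]
        congr 1
        ring
    calc _ = ∑ i : Fin s × Fin s × Fin q, 1 / p * t ^ (2 * r) *
          (Fintype.card (Fin s → Fin s → Equiv.Perm (Fin q))
            - Fintype.card (Fin s → Fin s → Equiv.Perm (Fin q)) * (1 / 2)) := by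
          simp only [Finset.sum_const, Finset.card_univ, Fintype.card_prod, Fintype.card_fin,
            nsmul_eq_mul]
          push_cast
          ring
      _ ≤ _ := by
          refine Finset.sum_le_sum fun i _ => ?_
          rw [← Finset.mul_sum, Finset.sum_sub_distrib]
          have := hsucc i
          have h0 : (0 : ℝ) ≤ 1 / p * t ^ (2 * r) := by positivity
          refine mul_le_mul_of_nonneg_left ?_ h0
          simp only [Finset.sum_const, Finset.card_univ, nsmul_eq_mul, mul_one]
          linarith

end Permutation

/-! ### Couplings that are on or off -/

section Switch

variable {M s q : ℕ}

/-- The permutation of the parameter space which flips the switch `i` if `b` is true. -/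
def flipAt {I : Type*} [DecidableEq I] (i : I) (b : Bool) : Equiv.Perm (I → Bool) :=
  Function.Involutive.toPerm (fun σ => Function.update σ i (xor (σ i) b)) fun σ => by
    simp

theorem flipAt_apply {I : Type*} [DecidableEq I] (i : I) (b : Bool) (σ : I → Bool) :
    flipAt i b σ = Function.update σ i (xor (σ i) b) := rfl

/-- The couplings which are on or off, with size `δ m` at site `m`. A site with `δ m = 0` has no
couplings. -/
def switchValue (δ : Fin M → ℝ) (σ : Fin M × Fin s × Fin s × Fin q → Bool) :
    Fin M → Fin s → Fin s → Fin q → ℝ :=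
  fun m h g i => if σ (m, h, g, i) then δ m else 0

/-- Flipping one switch changes at most one entry, at the site of the switch. -/
theorem sum_permBlocks_flipAt_sub_sq_le (δ : Fin M → ℝ)
    (σ : Fin M × Fin s × Fin s × Fin q → Bool) (i : Fin M × Fin s × Fin s × Fin q) (b : Bool)
    (m : Fin M) :
    ∑ x, ∑ y, (permBlocks 1 (switchValue δ (flipAt i b σ) m)
        - permBlocks 1 (switchValue δ σ m)) x y ^ 2
      ≤ if m = i.1 then δ m ^ 2 else 0 := by
  obtain ⟨m₀, h, g, k⟩ := i
  have key : ∀ h' k' g' k'', (permBlocks 1 (switchValue δ (flipAt (m₀, h, g, k) b σ) m)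
      - permBlocks 1 (switchValue δ σ m)) (h', k') (g', k'') ^ 2
      ≤ if h' = h then if k' = k then if g' = g then if k'' = k then
        if m = m₀ then δ m ^ 2 else 0 else 0 else 0 else 0 else 0 := by
    intro h' k' g' k''
    have hentry : ∀ τ, permBlocks 1 (switchValue δ τ m) (h', k') (g', k'')
        = if k' = k'' then (if τ (m, h', g', k') then δ m else 0) else 0 := fun _ => rfl
    have hsq : ∀ b b' : Bool,
        ((if b then δ m else 0) - (if b' then δ m else 0)) ^ 2 ≤ δ m ^ 2 := by
      intro b b'
      cases b <;> cases b' <;> simp [sq_nonneg]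
    rw [Matrix.sub_apply, hentry, hentry, flipAt_apply]
    by_cases hk : k' = k''
    · subst hk
      simp only [if_true]
      by_cases hi : (m, h', g', k') = (m₀, h, g, k)
      · obtain ⟨rfl, rfl, rfl, rfl⟩ := by simpa only [Prod.mk.injEq] using hi
        simpa only [if_true] using hsq _ _
      · simp only [Function.update_of_ne hi, sub_self, zero_pow two_ne_zero]
        split_ifs <;> positivity
    · simp only [hk, if_false, sub_self, zero_pow two_ne_zero]
      split_ifs <;> positivity
  simp only [Fintype.sum_prod_type]
  refine (Finset.sum_le_sum fun h' _ => Finset.sum_le_sum fun i' _ => Finset.sum_le_sum fun g' _ =>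
    Finset.sum_le_sum fun j' _ => key h' i' g' j').trans (le_of_eq ?_)
  simp

/-- The tangent line inequality for the power `x ^ r`. -/
theorem rpow_tangent_le {r t y : ℝ} (hr : 1 ≤ r) (ht : 0 < t) (hy : 0 ≤ y) :
    r * t ^ (r - 1) * y - (r - 1) * t ^ r ≤ y ^ r := by
  have h1 := one_add_mul_self_le_rpow_one_add (s := y / t - 1) (by
    have : 0 ≤ y / t := by positivity
    linarith) hr
  rw [add_sub_cancel, Real.div_rpow hy ht.le, le_div_iff₀ (by positivity)] at h1
  rw [Real.rpow_sub_one ht.ne']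
  refine le_trans (le_of_eq ?_) h1
  field_simp
  ring

/-- Minimax lower bound over the independent on/off choices of the couplings of every site: each switch
is misread with probability at least `1 / 8`, at the cost `δ m / 2` in the entry of its site. -/
theorem ofReal_le_minimaxRisk_of_switches {M p : ℕ} {R : Type*} [Fintype R]
    (e : Fin p ≃ ((Fin s × Fin q) ⊕ (Fin s × Fin q)) ⊕ R) (n : Fin M → ℕ)
    (μ : Fin M → EuclideanSpace ℝ (Fin p)) {r a η : ℝ} (hr : 1 ≤ r) (ha : 0 < a) (hη : 0 ≤ η)
    {δ : Fin M → ℝ} (hδ0 : ∀ m, 0 ≤ δ m) (hδ1 : ∀ m, δ m ≤ η) (hs : 1 ≤ s)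
    (hsa : s * η ≤ a / 16) (hexp : ∀ m, Real.exp (8 / a ^ 2 * (n m * δ m ^ 2)) ≤ 3 / 2)
    {C : Set (MatTuple M p)} (hC : ∀ σ, precisionTuple e a 1 (switchValue δ σ) ∈ C) :
    ENNReal.ofReal (1 / p * (s * s * q * (wnorm₁ n δ / 16) ^ (2 * r)))
      ≤ minimaxRisk n μ (lossMat₁ n r) C := by
  set t := wnorm₁ n δ / 16 with ht
  have ht0 : 0 ≤ t := by have := wnorm₁_nonneg n δ; positivity
  rcases ht0.eq_or_lt with ht1 | ht1
  · rw [← ht1, Real.zero_rpow (by linarith)]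
    simp
  have hv : ∀ σ m h g i, |switchValue (s := s) (q := q) δ σ m h g i| ≤ η := fun σ m h g i => by
    unfold switchValue
    split_ifs
    · rw [abs_of_nonneg (hδ0 m)]
      exact hδ1 m
    · simpa using hη
  refine ofReal_le_minimaxRisk (Θ := Fin M × Fin s × Fin s × Fin q → Bool)
    (Ω := fun σ => precisionTuple e a 1 (switchValue δ σ)) hC fun T => ?_
  let A : Fin M × Fin s × Fin s × Fin q → Bool → Set (Data n p) := fun i b =>
    {X | |T.1 X i.1 (e.symm (.inl (.inl (i.2.1, i.2.2.2))))
        (e.symm (.inl (.inr (i.2.2.1, i.2.2.2)))) - if b then δ i.1 else 0| < δ i.1 / 2}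
  have hA : ∀ i b, MeasurableSet (A i b) := fun i b =>
    measurableSet_lt (continuous_abs.measurable.comp ((T.2 _ _ _).sub_const _)) measurable_const
  have hdisj : ∀ i, Pairwise (Function.onFun Disjoint (A i)) := by
    intro i b b' hbb
    refine Set.disjoint_left.2 fun X hX hX' => ?_
    simp only [A, Set.mem_ofPred_eq, abs_lt] at hX hX'
    cases b <;> cases b' <;> simp at hX hX' hbb <;> linarith [hX.1, hX.2, hX'.1, hX'.2]
  -- `c` and `d` come from the tangent line to `y ^ (2 r)` at `t`
  set c : Fin M × Fin s × Fin s × Fin q → ℝ := fun i =>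
    1 / p * (2 * r * t ^ (2 * r - 1)) * (1 / (totalSize n : ℝ) * (n i.1 * (δ i.1 / 2))) with hc
  set d : ℝ := 1 / p * (s * s * q * ((2 * r - 1) * t ^ (2 * r))) with hd
  have hc0 : ∀ i, 0 ≤ c i := fun i => by
    have := hδ0 i.1
    positivity
  refine ⟨fun σ => ∑ i, c i *
    (1 - (dataLaw n μ (precisionTuple e a 1 (switchValue δ σ))).real (A i (σ i))) - d,
    fun σ => ?_, ?_⟩
  · refine ofReal_le_lintegral_of_failure _ (fun i => A i (σ i)) (fun i => hA _ _) c d _ fun X => ?_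
    have hsplit : ∑ i, c i * (A i (σ i))ᶜ.indicator 1 X - d
        = 1 / p * ∑ i : Fin s × Fin s × Fin q, (2 * r * t ^ (2 * r - 1) *
          (1 / (totalSize n : ℝ) * ∑ m, n m * (δ m / 2 * (A (m, i) (σ (m, i)))ᶜ.indicator 1 X))
            - (2 * r - 1) * t ^ (2 * r)) := by
      rw [Finset.sum_sub_distrib, mul_sub]
      congr 1
      · rw [Fintype.sum_prod_type, Finset.sum_comm, Finset.mul_sum]
        refine Finset.sum_congr rfl fun i _ => ?_
        rw [Finset.mul_sum, Finset.mul_sum, Finset.mul_sum]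
        refine Finset.sum_congr rfl fun m _ => ?_
        simp only [hc]
        ring
      · simp only [hd, Finset.sum_const, Finset.card_univ, Fintype.card_prod, Fintype.card_fin,
          nsmul_eq_mul]
        push_cast
        ring
    rw [hsplit]
    refine mul_le_mul_of_nonneg_left ?_ (by positivity)
    refine le_trans (Finset.sum_le_sum fun i _ => ?_)
      (sum_wnorm₁_rpow_le_frobNorm_sq e n r a 1 (switchValue δ σ) (T.1 X))
    refine le_trans ?_ (Finset.single_le_sum
      (fun j _ => Real.rpow_nonneg (wnorm₁_nonneg n _) _) (Finset.mem_univ i.2.2))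
    refine le_trans ?_ (rpow_tangent_le (by linarith) ht1 (wnorm₁_nonneg n _))
    refine sub_le_sub_right (mul_le_mul_of_nonneg_left ?_ (by positivity)) _
    refine mul_le_mul_of_nonneg_left (Finset.sum_le_sum fun m _ =>
      mul_le_mul_of_nonneg_left ?_ (by positivity)) (by positivity)
    by_cases hX : X ∈ A (m, i) (σ (m, i))
    · rw [Set.indicator_of_notMem (by simpa using hX), mul_zero]
      exact abs_nonneg _
    · rw [Set.indicator_of_mem (by simpa using hX)]
      simp only [A, Set.mem_ofPred_eq, not_lt] at hX
      simpa [permBlocks, switchValue] using hX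
  · have hsucc : ∀ i : Fin M × Fin s × Fin s × Fin q,
        ∑ σ, (dataLaw n μ (precisionTuple e a 1 (switchValue δ σ))).real (A i (σ i))
          ≤ Fintype.card (Fin M × Fin s × Fin s × Fin q → Bool) * (7 / 8) := by
      intro i
      have h1 := sum_measureReal_success_le
        (fun σ => dataLaw n μ (precisionTuple e a 1 (switchValue δ σ)))
        (fun b => flipAt i b) (fun σ => σ i) (A i) (hA i) (hdisj i)
        (fun σ b b' hbb => by
          simpa [flipAt_apply] using hbb)
        (B := 3 / 2) (by positivity)
        (fun σ b => (secondMomentBound_precisionTuple (f := fun m => if m = i.1 then δ m ^ 2 else 0)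
          e n μ ha hs hη (hv σ) (hv _) hsa (sum_permBlocks_flipAt_sub_sq_le δ σ i b) fun m => by
            split_ifs
            · have := hδ0 m
              have := hδ1 m
              nlinarith
            · positivity).mono
          (ENNReal.ofReal_le_ofReal (le_trans (le_of_eq ?_) (hexp i.1))))
      · have h2 : √((3 : ℝ) / 2 / Fintype.card Bool) ≤ 7 / 8 := by
          rw [Real.sqrt_le_left (by norm_num)]
          norm_num
        exact h1.trans (by gcongr)
      · simp
    have hV : 1 / p * (s * s * q * t ^ (2 * r)) = ∑ i, c i * (1 / 8) - d := by
      have h1 : ∑ i, c i * (1 / 8) = 1 / p * (s * s * q * (2 * r * t ^ (2 * r - 1) * t)) := by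
        rw [Fintype.sum_prod_type]
        simp only [hc, Finset.sum_const, Finset.card_univ, Fintype.card_prod, Fintype.card_fin,
          nsmul_eq_mul]
        have h2 : t = 1 / (totalSize n : ℝ) * (∑ m, (n m : ℝ) * δ m) / 16 := by
          rw [ht, wnorm₁]
          simp only [abs_of_nonneg (hδ0 _)]
        calc _ = 1 / p * (s * s * q * (2 * r * t ^ (2 * r - 1) *
              (1 / (totalSize n : ℝ) * (∑ m, (n m : ℝ) * δ m) / 16))) := by
              simp only [Finset.mul_sum, Finset.sum_div]
              refine Finset.sum_congr rfl fun m _ => ?_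
              push_cast
              ring
          _ = _ := by rw [← h2]
      rw [h1, hd, Real.rpow_sub_one ht1.ne']
      field_simp
      ring
    rw [hV, mul_sub, Finset.sum_sub_distrib]
    simp only [Finset.sum_const, Finset.card_univ, nsmul_eq_mul]
    refine sub_le_sub_right ?_ _
    rw [Finset.sum_comm, Finset.mul_sum]
    refine Finset.sum_le_sum fun i _ => ?_
    rw [← Finset.mul_sum, Finset.sum_sub_distrib, mul_left_comm]
    refine mul_le_mul_of_nonneg_left ?_ (hc0 i)
    simp only [Finset.sum_const, Finset.card_univ, nsmul_eq_mul, mul_one]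
    linarith [hsucc i]

end Switch

/-! ### Sample sizes and rates -/

section SampleSizes

variable {M : ℕ} (n : Fin M → ℕ)

theorem minSize_le (m : Fin M) : minSize n ≤ n m := ciInf_le (OrderBot.bddBelow _) m

theorem minSize_le_totalSize (hM : 0 < M) : minSize n ≤ totalSize n :=
  (minSize_le n ⟨0, hM⟩).trans
    (Finset.single_le_sum (f := n) (fun _ _ => Nat.zero_le _) (Finset.mem_univ _))

/-- A sum over the sites in which a single site is missing, `M - 1 ≥ M / 2` being the number of the
others. -/
theorem le_sum_erase (hM : 2 ≤ M) (m₀ : Fin M) {f : Fin M → ℝ} {x : ℝ} (hx : 0 ≤ x)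
    (hf : ∀ m, m ≠ m₀ → x ≤ f m) (h0 : f m₀ = 0) : M / 2 * x ≤ ∑ m, f m := by
  rw [← Finset.add_sum_erase _ _ (Finset.mem_univ m₀), h0, zero_add]
  have h1 : ∑ m ∈ Finset.univ.erase m₀, x ≤ ∑ m ∈ Finset.univ.erase m₀, f m :=
    Finset.sum_le_sum fun m hm => hf m (Finset.ne_of_mem_erase hm)
  refine le_trans ?_ h1
  rw [Finset.sum_const, Finset.card_erase_of_mem (Finset.mem_univ _), Finset.card_univ,
    Fintype.card_fin, nsmul_eq_mul, Nat.cast_sub (by omega)]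
  have : (2 : ℝ) ≤ M := by exact_mod_cast hM
  push_cast
  gcongr
  linarith

theorem le_wnorm₁_indicator (hM : 2 ≤ M) (hn : 1 ≤ minSize n) {K : ℝ} (hK : 0 < K)
    (hKn : (totalSize n : ℝ) ≤ K * (minSize n * M)) (m₀ : Fin M) :
    1 / (2 * K) ≤ wnorm₁ n (fun m => if m = m₀ then 0 else 1) := by
  have hN : (0 : ℝ) < totalSize n := by
    exact_mod_cast lt_of_lt_of_le hn (minSize_le_totalSize n (by omega))
  have h1 := le_sum_erase hM m₀ (f := fun m => (n m : ℝ) * |if m = m₀ then 0 else 1|)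
    (x := minSize n) (by positivity) (fun m hm => by
      simpa [hm] using minSize_le n m) (by simp)
  unfold wnorm₁
  rw [one_div_mul_eq_div, div_le_div_iff₀ (by positivity) hN]
  nlinarith

theorem le_wnorm₁_sqrt (hM : 2 ≤ M) (hn : 1 ≤ minSize n) {K c : ℝ} (hK : 0 < K) (hc : 0 ≤ c)
    (hKn : (totalSize n : ℝ) ≤ K * (minSize n * M)) (m₀ : Fin M) :
    √c / (2 * √K) * √(M / totalSize n)
      ≤ wnorm₁ n (fun m => if m = m₀ then 0 else √(c / n m)) := by
  have hN : (0 : ℝ) < totalSize n := by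
    exact_mod_cast lt_of_lt_of_le hn (minSize_le_totalSize n (by omega))
  have hM0 : (0 : ℝ) < M := by exact_mod_cast (by omega : 0 < M)
  have h1 := le_sum_erase hM m₀
    (f := fun m => (n m : ℝ) * |if m = m₀ then 0 else √(c / n m)|)
    (x := √c * √(minSize n)) (by positivity) (fun m hm => by
      have h2 : (1 : ℝ) ≤ n m := by exact_mod_cast hn.trans (minSize_le n m)
      have h3 : (minSize n : ℝ) ≤ n m := by exact_mod_cast minSize_le n m
      have h4 : (n m : ℝ) * √(c / n m) = √c * √(n m) := by
        rw [Real.sqrt_div hc]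
        have := Real.sqrt_pos.2 (lt_of_lt_of_le one_pos h2)
        nth_rewrite 1 [← Real.mul_self_sqrt (show (0 : ℝ) ≤ n m by positivity)]
        field_simp
      simp only [hm, if_false]
      rw [abs_of_nonneg (Real.sqrt_nonneg _), h4]
      gcongr) (by simp)
  have h5 : √(M / totalSize n) ≤ √K * (M * √(minSize n) / totalSize n) := by
    rw [Real.sqrt_le_left (by positivity), mul_pow, div_pow, mul_pow, Real.sq_sqrt hK.le,
      Real.sq_sqrt (by positivity)]
    rw [← mul_div_assoc, div_le_div_iff₀ hN (by positivity)]
    nlinarith [mul_le_mul_of_nonneg_left hKn (mul_pos hM0 hN).le]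
  have hK' := Real.sqrt_pos.2 hK
  unfold wnorm₁
  calc _ ≤ √c / (2 * √K) * (√K * (M * √(minSize n) / totalSize n)) := by gcongr
    _ = 1 / (totalSize n : ℝ) * (M / 2 * (√c * √(minSize n))) := by field_simp
    _ ≤ _ := by gcongr

end SampleSizes

theorem exists_equiv_bipartite {p s q : ℕ} (h : 2 * s * q ≤ p) :
    Nonempty (Fin p ≃ ((Fin s × Fin q) ⊕ (Fin s × Fin q)) ⊕ Fin (p - 2 * s * q)) := by
  refine ⟨Fintype.equivOfCardEq ?_⟩
  simp only [Fintype.card_fin, Fintype.card_sum, Fintype.card_prod]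
  have : 2 * s * q = s * q + s * q := by ring
  omega

/-- The block size `q = p / (2 s)` leaves room for the two copies of `Fin s × Fin q`, which together
fill at least half of the `p` vertices. -/
theorem exists_block_size {p s : ℕ} (hs : 1 ≤ s) (hsp : (s : ℝ) < p / 2) :
    ∃ q, 1 ≤ q ∧ 2 * s * q ≤ p ∧ (p : ℝ) ≤ 4 * (s * q) := by
  have h2 : 2 * s < p := by
    have : (2 * s : ℝ) < p := by linarith
    exact_mod_cast this
  have hq : 1 ≤ p / (2 * s) := (Nat.one_le_div_iff (by omega)).2 h2.le
  refine ⟨p / (2 * s), hq, Nat.mul_div_le p (2 * s), ?_⟩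
  have h3 := Nat.lt_div_mul_add (a := p) (b := 2 * s) (by omega)
  have h4 : p ≤ 4 * (s * (p / (2 * s))) := by
    have h5 : 2 * s ≤ 2 * s * (p / (2 * s)) := Nat.le_mul_of_pos_right _ hq
    have h6 : p / (2 * s) * (2 * s) = 2 * s * (p / (2 * s)) := mul_comm _ _
    have h7 : 4 * (s * (p / (2 * s))) = 2 * s * (p / (2 * s)) + 2 * s * (p / (2 * s)) := by ring
    omega
  exact_mod_cast h4

section Rates

variable {M p s : ℕ} (n : Fin M → ℕ) (μ : Fin M → EuclideanSpace ℝ (Fin p))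
  {C : Set (MatTuple M p)} {r a : ℝ}

theorem psi₁_nonneg : 0 ≤ psi₁ n p := Real.sqrt_nonneg _

/-- The lower bound of order `s ψ₁ ^ (2 r)`. Whether the couplings count as common or heterogeneous
entries depends on the weights `w` only. -/
theorem le_minimaxRisk_psi₁ (hr : 0 < r) (ha : 0 < a) {w : Fin M → ℝ} (hw0 : ∀ m, 0 ≤ w m)
    (hw1 : ∀ m, w m ≤ 1) (hs : 1 ≤ s) (hsp : (s : ℝ) < p / 2) (hp : 65536 ≤ p)
    (hs2 : (s : ℝ) ^ 2 ≤ p) (hN : 0 < totalSize n)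
    (hsa : s * (√(a ^ 2 / 128) * psi₁ n p) ≤ a / 16)
    (hC : ∀ (q k : ℕ) (e : Fin p ≃ ((Fin s × Fin q) ⊕ (Fin s × Fin q)) ⊕ Fin k) π,
      precisionTuple e a π (fun m _ _ _ => w m * (√(a ^ 2 / 128) * psi₁ n p)) ∈ C)
    {η : ℝ} (hη : 0 ≤ η) (hηw : η ≤ wnorm₁ n w) :
    ENNReal.ofReal (1 / 8 * (η * √(a ^ 2 / 128) / 2) ^ (2 * r) * (s * psi₁ n p ^ (2 * r)))
      ≤ minimaxRisk n μ (lossMat₁ n r) C := by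
  obtain ⟨q, hq1, hqp, hpq⟩ := exists_block_size hs hsp
  obtain ⟨e⟩ := exists_equiv_bipartite hqp
  have hp0 : (65536 : ℝ) ≤ p := by exact_mod_cast hp
  have hlog : 0 ≤ Real.log p := Real.log_nonneg (by linarith)
  have hψ := psi₁_nonneg (p := p) n
  have hs0 : (0 : ℝ) < s := by exact_mod_cast hs
  refine le_trans (ENNReal.ofReal_le_ofReal ?_) (ofReal_le_minimaxRisk_of_permutations e n μ hr ha
    (ε := √(a ^ 2 / 128) * psi₁ n p) (by positivity) hw0 hw1 hs hq1 hsa ?_ (hC q _ e))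
  · calc _ = s / 8 * (η * (√(a ^ 2 / 128) * psi₁ n p) / 2) ^ (2 * r) := by
          rw [show η * (√(a ^ 2 / 128) * psi₁ n p) / 2
            = η * √(a ^ 2 / 128) / 2 * psi₁ n p by ring, Real.mul_rpow (by positivity) hψ]
          ring
      _ ≤ s / 8 * (wnorm₁ n w * (√(a ^ 2 / 128) * psi₁ n p) / 2) ^ (2 * r) := by gcongr
      _ ≤ (1 / p * (s * s * q / 2)) * (wnorm₁ n w * (√(a ^ 2 / 128) * psi₁ n p) / 2) ^ (2 * r) := by
          have := wnorm₁_nonneg n w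
          gcongr
          rw [one_div_mul_eq_div, div_le_div_iff₀ (by norm_num) (by linarith)]
          nlinarith
      _ = _ := by ring
  · -- the exponent equals `log p / 4`, and `q ≥ √p / 4`
    have hN' : (0 : ℝ) < totalSize n := by exact_mod_cast hN
    have h1 : 32 / a ^ 2 * (totalSize n * (√(a ^ 2 / 128) * psi₁ n p) ^ 2)
        = Real.log p * (1 / 4) := by
      rw [mul_pow, psi₁, Real.sq_sqrt (by positivity), Real.sq_sqrt (by positivity)]
      field_simp
      ring
    rw [h1, ← Real.rpow_def_of_pos (by linarith)]
    set y := (p : ℝ) ^ (1 / 4 : ℝ) with hy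
    have hy4 : y ^ 4 = p := by
      rw [hy, ← Real.rpow_natCast, ← Real.rpow_mul (by linarith)]
      norm_num
    have hy0 : 0 ≤ y := by positivity
    have hy16 : 16 ≤ y := by
      by_contra hcon
      push Not at hcon
      have : y ^ 4 < 16 ^ 4 := pow_lt_pow_left₀ hcon hy0 (by norm_num)
      rw [hy4] at this
      linarith
    have hsy : (s : ℝ) ≤ y ^ 2 := by
      refine (pow_le_pow_iff_left₀ hs0.le (by positivity) two_ne_zero).1 ?_
      calc (s : ℝ) ^ 2 ≤ p := hs2
        _ = _ := by rw [← hy4]; ring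
    have hyq : y ^ 2 ≤ 4 * q := by
      have h2 : y ^ 2 * y ^ 2 ≤ y ^ 2 * (4 * q) := by
        calc y ^ 2 * y ^ 2 = p := by rw [← hy4]; ring
          _ ≤ 4 * (s * q) := hpq
          _ ≤ 4 * (y ^ 2 * q) := by gcongr
          _ = _ := by ring
      exact le_of_mul_le_mul_left h2 (by positivity)
    nlinarith

/-- The lower bound of order `s (M / N) ^ r`, from couplings of size `a / √(32 n m)` at all sites `m`
other than `m₀`. -/
theorem le_minimaxRisk_sites (hr : 1 ≤ r) (ha : 0 < a) (hs : 1 ≤ s) (hsp : (s : ℝ) < p / 2)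
    (hM : 2 ≤ M) (hn : 1 ≤ minSize n) {K : ℝ} (hK : 0 < K)
    (hKn : (totalSize n : ℝ) ≤ K * (minSize n * M)) (m₀ : Fin M)
    (hsa : s * √(a ^ 2 / 32 / minSize n) ≤ a / 16)
    (hC : ∀ (q k : ℕ) (e : Fin p ≃ ((Fin s × Fin q) ⊕ (Fin s × Fin q)) ⊕ Fin k) σ,
      precisionTuple e a 1 (switchValue (fun m => if m = m₀ then 0 else √(a ^ 2 / 32 / n m)) σ)
        ∈ C) :
    ENNReal.ofReal (1 / 4 * (√(a ^ 2 / 32) / (2 * √K) / 16) ^ (2 * r) *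
        (s * √(M / totalSize n) ^ (2 * r)))
      ≤ minimaxRisk n μ (lossMat₁ n r) C := by
  obtain ⟨q, hq1, hqp, hpq⟩ := exists_block_size hs hsp
  obtain ⟨e⟩ := exists_equiv_bipartite hqp
  have hs0 : (0 : ℝ) < s := by exact_mod_cast hs
  have hp0 : (0 : ℝ) < p := by linarith
  have hn0 : (0 : ℝ) < minSize n := by exact_mod_cast hn
  have hnm : ∀ m, (minSize n : ℝ) ≤ n m := fun m => by exact_mod_cast minSize_le n m
  refine le_trans (ENNReal.ofReal_le_ofReal ?_) (ofReal_le_minimaxRisk_of_switches e n μ hr ha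
    (η := √(a ^ 2 / 32 / minSize n)) (by positivity)
    (δ := fun m => if m = m₀ then 0 else √(a ^ 2 / 32 / n m))
    (fun m => by split_ifs <;> positivity) (fun m => ?_) hs hsa (fun m => ?_) (hC q _ e))
  · have h1 := le_wnorm₁_sqrt n hM hn hK (c := a ^ 2 / 32) (by positivity) hKn m₀
    calc _ = s / 4 * (√(a ^ 2 / 32) / (2 * √K) * √(M / totalSize n) / 16) ^ (2 * r) := by
          rw [mul_div_right_comm _ (√(M / totalSize n)), Real.mul_rpow (by positivity)
            (by positivity)]
          ring
      _ ≤ s / 4 * (wnorm₁ n (fun m => if m = m₀ then 0 else √(a ^ 2 / 32 / n m)) / 16) ^ (2 * r) := by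
          gcongr
      _ ≤ (1 / p * (s * s * q)) *
          (wnorm₁ n (fun m => if m = m₀ then 0 else √(a ^ 2 / 32 / n m)) / 16) ^ (2 * r) := by
          have := wnorm₁_nonneg n (fun m => if m = m₀ then 0 else √(a ^ 2 / 32 / n m))
          gcongr
          rw [one_div_mul_eq_div, div_le_div_iff₀ (by norm_num) hp0]
          nlinarith
      _ = _ := by ring
  · split_ifs
    · positivity
    · have := hnm m
      gcongr
  · have hexp : Real.exp (1 / 4) ≤ 3 / 2 := by
      refine (pow_le_pow_iff_left₀ (Real.exp_pos _).le (by norm_num) four_ne_zero).1 ?_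
      rw [← Real.exp_nat_mul]
      norm_num
      linarith [Real.exp_one_lt_d9]
    refine le_trans (Real.exp_le_exp.2 ?_) hexp
    have h0 : (0 : ℝ) < n m := lt_of_lt_of_le hn0 (hnm m)
    split_ifs
    · norm_num
    · rw [Real.sq_sqrt (by positivity)]
      field_simp
      norm_num

end Rates

/-- The base value `a` of the diagonal: perturbations of size at most `ρ` of `a I` satisfy the spectral
constraints. -/
theorem exists_center {Cmin Cmax : ℝ} (hCmin : 0 < Cmin) (hC : Cmin < Cmax) :
    ∃ a ρ : ℝ, 0 < a ∧ 0 < ρ ∧ ρ ≤ a / 16 ∧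
      ∀ x, 0 ≤ x → x ≤ ρ → Cmin ≤ (a + x)⁻¹ ∧ (a - x)⁻¹ ≤ Cmax := by
  have hmax : 0 < Cmax := hCmin.trans hC
  have h1 : Cmax⁻¹ < Cmin⁻¹ := inv_strictAnti₀ hCmin hC
  have h0 : 0 < Cmax⁻¹ := inv_pos.2 hmax
  refine ⟨(Cmin⁻¹ + Cmax⁻¹) / 2, min ((Cmin⁻¹ + Cmax⁻¹) / 2 / 16) ((Cmin⁻¹ - Cmax⁻¹) / 2),
    by positivity, lt_min (by positivity) (by linarith), min_le_left _ _, fun x hx0 hx => ?_⟩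
  have hx2 := hx.trans (min_le_right _ _)
  constructor
  · rw [le_inv_comm₀ hCmin (by linarith)]
    linarith
  · rw [inv_le_comm₀ (by linarith) hmax]
    linarith

theorem add_rpow_le_two_rpow {x y r : ℝ} (hx : 0 ≤ x) (hy : 0 ≤ y) (hr : 0 ≤ r) :
    (x + y) ^ r ≤ 2 ^ r * (x ^ r + y ^ r) := by
  have hxr := Real.rpow_nonneg hx r
  have hyr := Real.rpow_nonneg hy r
  have h2 : (0 : ℝ) ≤ 2 ^ r := by positivity
  rcases le_total x y with h | h
  · calc (x + y) ^ r ≤ (2 * y) ^ r := Real.rpow_le_rpow (by positivity) (by linarith) hr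
      _ = 2 ^ r * y ^ r := Real.mul_rpow (by norm_num) hy
      _ ≤ _ := by gcongr; linarith
  · calc (x + y) ^ r ≤ (2 * x) ^ r := Real.rpow_le_rpow (by positivity) (by linarith) hr
      _ = 2 ^ r * x ^ r := Real.mul_rpow (by norm_num) hx
      _ ≤ _ := by gcongr; linarith

theorem psi₂_rpow_le {M p : ℕ} (n : Fin M → ℕ) {r : ℝ} (hr : 0 ≤ r) :
    psi₂ n p ^ r ≤ 2 ^ r * (psi₁ n p ^ r + √(M / totalSize n) ^ r) := by
  have h1 : psi₂ n p ≤ psi₁ n p + √(M / totalSize n) := by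
    have hlog : 0 ≤ Real.log p := Real.log_natCast_nonneg p
    unfold psi₁ psi₂
    have hx : 0 ≤ (M : ℝ) / totalSize n := by positivity
    have hy : 0 ≤ Real.log p / totalSize n := by positivity
    rw [add_div]
    refine Real.sqrt_le_iff.2 ⟨by positivity, ?_⟩
    rw [add_sq, Real.sq_sqrt hx, Real.sq_sqrt hy]
    nlinarith [mul_nonneg (Real.sqrt_nonneg (Real.log p / totalSize n))
      (Real.sqrt_nonneg ((M : ℝ) / totalSize n))]
  exact (Real.rpow_le_rpow (Real.sqrt_nonneg _) h1 hr).trans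
    (add_rpow_le_two_rpow (Real.sqrt_nonneg _) (Real.sqrt_nonneg _) hr)

/-- The minimax lower bound under explicit inequalities between the parameters. -/
theorem exists_le_minimaxRisk {r Cmin Cmax K : ℝ} (hr : 1 ≤ r) (hCmin : 0 < Cmin)
    (hC : Cmin < Cmax) (hK : 0 < K) :
    ∃ c θ : ℝ, 0 < c ∧ 0 < θ ∧ ∀ (M p s₁ s₂ : ℕ) (n : Fin M → ℕ)
      (μ : Fin M → EuclideanSpace ℝ (Fin p)), 2 ≤ M → 1 ≤ minSize n → 65536 ≤ p →
      3 ≤ s₁ → (s₁ : ℝ) < p / 2 → 2 ≤ s₂ → (s₂ : ℝ) < p / 2 → totalSize n ≤ p →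
      ((max s₁ s₂ : ℕ) : ℝ) ^ 2 * Real.log p ^ 3 ≤ θ * totalSize n →
      (s₂ : ℝ) ^ 2 * M ≤ θ * totalSize n → (totalSize n : ℝ) ≤ K * (minSize n * M) →
      ENNReal.ofReal (c * (s₁ * psi₁ n p ^ (2 * r) + s₂ * psi₂ n p ^ (2 * r)))
        ≤ minimaxRisk n μ (lossMat₁ n r) (sparseClass M p s₁ s₂ ∩ regularClass M p Cmin Cmax) := by
  obtain ⟨a, ρ, ha, hρ, hρa, hreg⟩ := exists_center hCmin hC
  set c₁ := 1 / 8 * (1 * √(a ^ 2 / 128) / 2) ^ (2 * r) / 2 with hc₁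
  set c₂ := 1 / 8 * (1 / (2 * K) * √(a ^ 2 / 128) / 2) ^ (2 * r) with hc₂
  set c₃ := 1 / 4 * (√(a ^ 2 / 32) / (2 * √K) / 16) ^ (2 * r) with hc₃
  have hc₁0 : 0 < c₁ := by positivity
  have hc₂0 : 0 < c₂ := by positivity
  have hc₃0 : 0 < c₃ := by positivity
  set c := min c₁ (min c₂ c₃ / 2 ^ (2 * r)) / 3 with hc
  set θ := min 1 (min (128 * ρ ^ 2 / a ^ 2) (32 * ρ ^ 2 / (a ^ 2 * K))) with hθ
  have hc0 : 0 < c := by positivity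
  have hθ0 : 0 < θ := by positivity
  have hθ1 : θ ≤ 1 := min_le_left _ _
  have hθ2 : θ ≤ 128 * ρ ^ 2 / a ^ 2 := (min_le_right _ _).trans (min_le_left _ _)
  have hθ3 : θ ≤ 32 * ρ ^ 2 / (a ^ 2 * K) := (min_le_right _ _).trans (min_le_right _ _)
  clear_value c₁ c₂ c₃ c θ
  refine ⟨c, θ, hc0, hθ0, ?_⟩
  intro M p s₁ s₂ n μ hM hn hp hs₁ hs₁p hs₂ hs₂p hNp hlog hsites hKn
  have hN : 0 < totalSize n := lt_of_lt_of_le hn (minSize_le_totalSize n (by omega))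
  have hN' : (0 : ℝ) < totalSize n := by exact_mod_cast hN
  have hNp' : (totalSize n : ℝ) ≤ p := by exact_mod_cast hNp
  have hp' : (65536 : ℝ) ≤ p := by exact_mod_cast hp
  have hn0 : (0 : ℝ) < minSize n := by exact_mod_cast hn
  have hl1 : 1 ≤ Real.log p := by
    rw [Real.le_log_iff_exp_le (by linarith)]
    linarith [Real.exp_one_lt_d9]
  have hψ := psi₁_nonneg (p := p) n
  set m₀ : Fin M := ⟨0, by omega⟩
  -- consequences of the growth conditions for any sparsity `s ≤ max s₁ s₂`
  have hsq : ∀ s : ℕ, s ≤ max s₁ s₂ → (s : ℝ) ^ 2 ≤ p ∧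
      s * (√(a ^ 2 / 128) * psi₁ n p) ≤ ρ := by
    intro s hs
    have hs' : (s : ℝ) ^ 2 ≤ ((max s₁ s₂ : ℕ) : ℝ) ^ 2 := by
      have : (s : ℝ) ≤ ((max s₁ s₂ : ℕ) : ℝ) := by exact_mod_cast hs
      gcongr
    have hl3 : Real.log p ≤ Real.log p ^ 3 := le_self_pow₀ hl1 (by norm_num)
    have h1 : (s : ℝ) ^ 2 * Real.log p ≤ θ * totalSize n :=
      (mul_le_mul hs' hl3 (by linarith) (by positivity)).trans hlog
    constructor
    · nlinarith [sq_nonneg (s : ℝ)]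
    · refine (pow_le_pow_iff_left₀ (by positivity) hρ.le two_ne_zero).1 ?_
      rw [mul_pow, mul_pow, psi₁, Real.sq_sqrt (by positivity), Real.sq_sqrt (by positivity)]
      calc (s : ℝ) ^ 2 * (a ^ 2 / 128 * (Real.log p / totalSize n))
          = a ^ 2 / 128 * ((s : ℝ) ^ 2 * Real.log p / totalSize n) := by ring
        _ ≤ a ^ 2 / 128 * (128 * ρ ^ 2 / a ^ 2) := by
            refine mul_le_mul_of_nonneg_left ?_ (by positivity)
            rw [div_le_iff₀ hN']
            exact h1.trans (by gcongr)
        _ = ρ ^ 2 := by field_simp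
  set P := psi₁ n p ^ (2 * r) with hP
  set Φ := √(M / totalSize n) ^ (2 * r) with hΦ
  have hP0 : 0 ≤ P := Real.rpow_nonneg hψ _
  have hΦ0 : 0 ≤ Φ := by positivity
  set Cl := sparseClass M p s₁ s₂ ∩ regularClass M p Cmin Cmax
  have hV₁ : ENNReal.ofReal (c₁ * (s₁ * P)) ≤ minimaxRisk n μ (lossMat₁ n r) Cl := by
    -- one entry of each column is taken by the diagonal
    have hcast : ((s₁ - 1 : ℕ) : ℝ) = s₁ - 1 := by
      rw [Nat.cast_sub (by omega), Nat.cast_one]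
    have hs3 : (3 : ℝ) ≤ s₁ := by exact_mod_cast hs₁
    obtain ⟨h1, h2⟩ := hsq (s₁ - 1) (by omega)
    have h3 := hreg _ (by positivity) h2
    have h4 : ∀ m : Fin M, ∀ h g : Fin (s₁ - 1),
        |(1 : ℝ) * (√(a ^ 2 / 128) * psi₁ n p)| ≤ √(a ^ 2 / 128) * psi₁ n p := fun _ _ _ => by
      rw [one_mul, abs_of_nonneg (by positivity)]
    refine le_trans (ENNReal.ofReal_le_ofReal ?_)
      (le_minimaxRisk_psi₁ n μ (C := Cl) (s := s₁ - 1) (w := fun _ => 1) (η := 1) (by linarith) ha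
      (fun _ => zero_le_one) (fun _ => le_rfl) (by omega) (by rw [hcast]; linarith) hp h1 hN
      (h2.trans hρa) (fun q k e π => Set.mem_inter ?_ ?_) zero_le_one ?_)
    · calc c₁ * (s₁ * P) = 1 / 8 * (1 * √(a ^ 2 / 128) / 2) ^ (2 * r) * (s₁ / 2 * P) := by
            rw [hc₁]; ring
        _ ≤ _ := by
            gcongr
            rw [hcast]
            linarith
    · exact precisionTuple_mem_sparseClass_of_common e (by positivity)
        (fun m h g _ => h4 m h g) (by linarith) (by omega) (by omega) fun _ _ => rfl
    · exact precisionTuple_mem_regularClass e (by positivity) (fun m h g _ => h4 m h g)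
        (by linarith) h3.1 h3.2
    · have : ∑ m, (n m : ℝ) = totalSize n := by simp [totalSize]
      simp [wnorm₁, this, hN'.ne']
  have hV₂ : ENNReal.ofReal (c₂ * (s₂ * P)) ≤ minimaxRisk n μ (lossMat₁ n r) Cl := by
    obtain ⟨h1, h2⟩ := hsq s₂ (le_max_right _ _)
    have h3 := hreg _ (by positivity) h2
    have h4 : ∀ m : Fin M, |(if m = m₀ then (0 : ℝ) else 1) * (√(a ^ 2 / 128) * psi₁ n p)|
        ≤ √(a ^ 2 / 128) * psi₁ n p := fun m => by
      rw [abs_of_nonneg (by positivity)]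
      split_ifs
      · rw [zero_mul]; positivity
      · rw [one_mul]
    rw [hc₂]
    refine le_minimaxRisk_psi₁ n μ (C := Cl) (s := s₂) (w := fun m => if m = m₀ then 0 else 1)
      (η := 1 / (2 * K)) (by linarith) ha
      (fun m => by positivity) (fun m => by split_ifs <;> norm_num) (by omega) hs₂p hp h1 hN
      (h2.trans hρa) (fun q k e π => Set.mem_inter ?_ ?_) (by positivity)
      (le_wnorm₁_indicator n hM hn hK hKn m₀)
    · exact precisionTuple_mem_sparseClass_of_eq_zero e (m₀ := m₀) (by positivity)
        (fun m _ _ _ => h4 m) (by linarith) (by omega) le_rfl (by ext; simp)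
    · exact precisionTuple_mem_regularClass e (by positivity) (fun m _ _ _ => h4 m)
        (by linarith) h3.1 h3.2
  have hV₃ : ENNReal.ofReal (c₃ * (s₂ * Φ)) ≤ minimaxRisk n μ (lossMat₁ n r) Cl := by
    have h2 : s₂ * √(a ^ 2 / 32 / minSize n) ≤ ρ := by
      refine (pow_le_pow_iff_left₀ (by positivity) hρ.le two_ne_zero).1 ?_
      rw [mul_pow, Real.sq_sqrt (by positivity)]
      have h5 : (s₂ : ℝ) ^ 2 / minSize n ≤ θ * K := by
        rw [div_le_iff₀ hn0]
        have hM0 : (0 : ℝ) < M := by exact_mod_cast (by omega : 0 < M)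
        refine le_of_mul_le_mul_right ?_ hM0
        calc _ ≤ θ * totalSize n := hsites
          _ ≤ θ * (K * (minSize n * M)) := by gcongr
          _ = _ := by ring
      calc (s₂ : ℝ) ^ 2 * (a ^ 2 / 32 / minSize n)
          = a ^ 2 / 32 * ((s₂ : ℝ) ^ 2 / minSize n) := by ring
        _ ≤ a ^ 2 / 32 * (32 * ρ ^ 2 / (a ^ 2 * K) * K) := by
            refine mul_le_mul_of_nonneg_left ?_ (by positivity)
            exact h5.trans (by gcongr)
        _ = ρ ^ 2 := by field_simp
    have h3 := hreg _ (by positivity) h2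
    have h6 : ∀ m, |if m = m₀ then 0 else √(a ^ 2 / 32 / n m)| ≤ √(a ^ 2 / 32 / minSize n) := by
      intro m
      have : (minSize n : ℝ) ≤ n m := by exact_mod_cast minSize_le n m
      split_ifs
      · rw [abs_zero]
        positivity
      · rw [abs_of_nonneg (Real.sqrt_nonneg _)]
        gcongr
    have h4 : ∀ {q : ℕ} (σ : Fin M × Fin s₂ × Fin s₂ × Fin q → Bool) m h g i,
        |switchValue (fun m => if m = m₀ then 0 else √(a ^ 2 / 32 / n m)) σ m h g i|
          ≤ √(a ^ 2 / 32 / minSize n) := by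
      intro q σ m h g i
      unfold switchValue
      by_cases hσ : σ (m, h, g, i)
      · rw [if_pos hσ]
        exact h6 m
      · rw [if_neg hσ, abs_zero]
        positivity
    rw [hc₃]
    refine le_minimaxRisk_sites n μ (C := Cl) hr ha (by omega) hs₂p hM hn hK hKn m₀ (h2.trans hρa)
      fun q k e σ => Set.mem_inter ?_ ?_
    · exact precisionTuple_mem_sparseClass_of_eq_zero e (m₀ := m₀) (by positivity)
        (h4 σ) (by linarith) (by omega) le_rfl (by ext; simp [switchValue])
    · exact precisionTuple_mem_regularClass e (by positivity) (h4 σ) (by linarith) h3.1 h3.2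
  -- the target is at most the mean of the three lower bounds
  have hsum : c * (s₁ * P + s₂ * psi₂ n p ^ (2 * r))
      ≤ (c₁ * (s₁ * P) + c₂ * (s₂ * P) + c₃ * (s₂ * Φ)) / 3 := by
    have h1 := psi₂_rpow_le (p := p) n (r := 2 * r) (by linarith)
    have h2 : (0 : ℝ) < 2 ^ (2 * r) := by positivity
    have h3 : c ≤ c₁ / 3 := by rw [hc]; gcongr; exact min_le_left _ _
    have h4 : c * 2 ^ (2 * r) ≤ min c₂ c₃ / 3 := by
      calc c * 2 ^ (2 * r) ≤ min c₂ c₃ / 2 ^ (2 * r) / 3 * 2 ^ (2 * r) := by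
            rw [hc]; gcongr; exact min_le_right _ _
        _ = _ := by field_simp
    have h5 := min_le_left c₂ c₃
    have h6 := min_le_right c₂ c₃
    calc c * (s₁ * P + s₂ * psi₂ n p ^ (2 * r))
        ≤ c * (s₁ * P + s₂ * (2 ^ (2 * r) * (P + Φ))) := by gcongr
      _ = c * (s₁ * P) + (c * 2 ^ (2 * r)) * (s₂ * P) + (c * 2 ^ (2 * r)) * (s₂ * Φ) := by ring
      _ ≤ c₁ / 3 * (s₁ * P) + c₂ / 3 * (s₂ * P) + c₃ / 3 * (s₂ * Φ) := by
          gcongr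
          · linarith
          · linarith
      _ = _ := by ring
  by_contra hcon
  have hlt : ∀ x, ENNReal.ofReal x ≤ minimaxRisk n μ (lossMat₁ n r) Cl →
      x < c * (s₁ * P + s₂ * psi₂ n p ^ (2 * r)) := fun x hx => by
    by_contra h
    push Not at h
    exact hcon ((ENNReal.ofReal_le_ofReal h).trans hx)
  linarith [hlt _ hV₁, hlt _ hV₂, hlt _ hV₃]

end PrecisionMinimax

theorem theorem4 (r Cmin Cmax β K κ : ℝ) (hr : 1 ≤ r) (hCmin : 0 < Cmin) (hC : Cmin < Cmax)
    (hβ : 1 < β) (hK : 0 < K) (hκ : 0 < κ) :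
    ∃ c : ℝ, 0 < c ∧
      ∀ (M p s₁ s₂ : ℕ → ℕ) (n : (t : ℕ) → Fin (M t) → ℕ)
        (μ : (t : ℕ) → Fin (M t) → EuclideanSpace ℝ (Fin (p t))),
        (∀ t, 2 ≤ M t) →
        Tendsto (fun t => minSize (n t)) atTop atTop →
        Tendsto p atTop atTop →
        (∀ t, 3 ≤ s₁ t ∧ (s₁ t : ℝ) < (p t : ℝ) / 2) →
        (∀ t, 2 ≤ s₂ t ∧ (s₂ t : ℝ) < (p t : ℝ) / 2) →
        ((fun t => ((max (s₁ t) (s₂ t) : ℕ) : ℝ) ^ 2 * Real.log (p t) ^ 3)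
          =o[atTop] fun t => (totalSize (n t) : ℝ)) →
        ((fun t => (s₂ t : ℝ) ^ 2 * (M t : ℝ)) =o[atTop] fun t => (totalSize (n t) : ℝ)) →
        (∀ᶠ t in atTop, (totalSize (n t) : ℝ) ≤ K * ((minSize (n t) : ℝ) * (M t : ℝ))) →
        (∀ᶠ t in atTop, κ * (totalSize (n t) : ℝ) ^ β ≤ (p t : ℝ)) →
        ∀ᶠ t in atTop,
          ENNReal.ofReal (c * ((s₁ t : ℝ) * psi₁ (n t) (p t) ^ (2 * r)
              + (s₂ t : ℝ) * psi₂ (n t) (p t) ^ (2 * r)))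
            ≤ minimaxRisk (n t) (μ t) (lossMat₁ (n t) r)
                (sparseClass (M t) (p t) (s₁ t) (s₂ t) ∩ regularClass (M t) (p t) Cmin Cmax) ∧
          ENNReal.ofReal (c * ((s₁ t : ℝ) * psi₁ (n t) (p t) ^ (2 * r)
              + (s₂ t : ℝ) * psi₂ (n t) (p t) ^ (2 * r)))
            ≤ minimaxRisk (n t) (μ t) (lossMat₂ (n t) r)
                (sparseClass (M t) (p t) (s₁ t) (s₂ t) ∩ regularClass (M t) (p t) Cmin Cmax) := by
  obtain ⟨c, θ, hc, hθ, h⟩ := exists_le_minimaxRisk hr hCmin hC hK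
  refine ⟨c, hc, fun M p s₁ s₂ n μ hM hn hp hs₁ hs₂ hlog hsites hKn hpN => ?_⟩
  have hNtop : Tendsto (fun t => (totalSize (n t) : ℝ)) atTop atTop :=
    tendsto_natCast_atTop_atTop.comp (tendsto_atTop_mono
      (fun t => minSize_le_totalSize (n t) (lt_of_lt_of_le two_pos (hM t))) hn)
  have hpow := ((tendsto_rpow_atTop (sub_pos.2 hβ)).comp hNtop).eventually_ge_atTop κ⁻¹
  filter_upwards [hn.eventually_ge_atTop 1, hp.eventually_ge_atTop 65536, hlog.bound hθ,
    hsites.bound hθ, hKn, hpN, hpow] with t h1 h2 h3 h4 h5 h6 h7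
  have hN : (0 : ℝ) < totalSize (n t) := by
    exact_mod_cast lt_of_lt_of_le h1 (minSize_le_totalSize (n t) (lt_of_lt_of_le two_pos (hM t)))
  -- `N = κ N κ⁻¹ ≤ κ N N ^ (β - 1) ≤ p`
  have hNp : totalSize (n t) ≤ p t := by
    have h8 : (totalSize (n t) : ℝ) ≤ p t := by
      refine le_trans ?_ h6
      rw [Function.comp_apply, Real.rpow_sub_one hN.ne', le_div_iff₀ hN,
        inv_mul_le_iff₀ hκ] at h7
      exact h7
    exact_mod_cast h8
  rw [Real.norm_of_nonneg (by have := Real.log_natCast_nonneg (p t); positivity),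
    Real.norm_of_nonneg hN.le] at h3
  rw [Real.norm_of_nonneg (by positivity), Real.norm_of_nonneg hN.le] at h4
  have key := h (M t) (p t) (s₁ t) (s₂ t) (n t) (μ t) (hM t) h1 h2 (hs₁ t).1 (hs₁ t).2 (hs₂ t).1
    (hs₂ t).2 hNp h3 h4 h5
  exact ⟨key, key.trans (minimaxRisk_lossMat₁_le_lossMat₂ _ _ (by linarith) _)⟩
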